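/- Let $\Omega\subset\mathbb{R}^2$ be open and bounded. Let $\gamma>0$, $s_0\ge 0$, $\kappa\ge-\gamma s_0$ be real constants and let $\rho\in C^\infty(\mathbb{R})$ satisfy $\rho(s)=0$ for $s\le 0$, $\rho$ convex on $[0,s_0]$, and $\rho(s)=\gamma s+\kappa$ for $s\ge s_0$. Let $u\in W^{1,2}(\Omega,\mathbb{R}^2)$ be a weak solution of the Euler–Lagrange equation of the functional $$I(u)=\int_\Omega \tfrac12|\nabla u|^2+\rho(\det\nabla u)\,dx,$$ that is, $$\int_\Omega\bigl(\nabla u+\rho'(\det\nabla u)\,\operatorname{cof}\nabla u\bigr)\cdot\nabla\varphi\,dx=0\qquad\text{for all }\varphi\in C_c^\infty(\Omega,\mathbb{R}^2),$$ where $\nabla u$ is the weak gradient, $(\nabla u)_{ij}=\partial_j u_i$, $\operatorname{cof}A=(\operatorname{adj}A)^T$, and $A\cdot B=\sum_{i,j}A_{ij}B_{ij}$. Then $u$ is locally Hölder continuous: there exists $\alpha\in(0,1)$ such that $u\in C^{0,\alpha}_{\mathrm{loc}}(\Omega,\mathbb{R}^2)$, i.e. $u$ has a representative (equal to $u$ almost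 everywhere in $\Omega$) that is Hölder continuous with exponent $\alpha$ on every compact subset of $\Omega$. -/

import Mathlib

open MeasureTheory
open scoped NNReal ContDiff

/-- The Euclidean plane `ℝ²`. -/
abbrev Plane : Type := EuclideanSpace ℝ (Fin 2)

/-- Real `2 × 2` matrices. -/
abbrev Mat2 : Type := Matrix (Fin 2) (Fin 2) ℝ

/-- The Frobenius inner product `A · B = ∑ᵢⱼ Aᵢⱼ Bᵢⱼ`. -/
def frobInner (A B : Mat2) : ℝ := ∑ i, ∑ j, A i j * B i j

/-- The cofactor matrix `cof A = (adj A)ᵀ`. -/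
def cof (A : Mat2) : Mat2 := A.adjugate.transpose

/-- `f ∈ C_c^∞(Ω, F)`: smooth, with compact support contained in `Ω`
(extended by zero to the whole plane). -/
structure IsTestFunction {F : Type*} [NormedAddCommGroup F] [NormedSpace ℝ F]
    (Ω : Set Plane) (f : Plane → F) : Prop where
  smooth : ContDiff ℝ ∞ f
  compact : HasCompactSupport f
  support_subset : tsupport f ⊆ Ω

/-- The `j`-th classical partial derivative of a map on the plane. -/
noncomputable def partialDeriv {F : Type*} [NormedAddCommGroup F] [NormedSpace ℝ F]
    (j : Fin 2) (f : Plane → F) (x : Plane) : F :=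
  fderiv ℝ f x (EuclideanSpace.single j 1)

/-- The classical gradient matrix `(∇φ)ᵢⱼ = ∂ⱼ φᵢ`. -/
noncomputable def gradMatrix (φ : Plane → Plane) (x : Plane) : Mat2 :=
  Matrix.of fun i j => partialDeriv j φ x i

/-- `u ∈ W^{1,2}(Ω, ℝ²)` with weak gradient `G`, where `Gᵢⱼ` is the weak derivative `∂ⱼ uᵢ`:
`u` and `G` are square integrable on `Ω`, and
`∫_Ω uᵢ ∂ⱼψ = - ∫_Ω Gᵢⱼ ψ` for every `ψ ∈ C_c^∞(Ω)`. -/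
structure IsW12WithGrad (Ω : Set Plane) (u : Plane → Plane) (G : Plane → Mat2) : Prop where
  memLp : MemLp u 2 (volume.restrict Ω)
  memLp_grad : ∀ i j, MemLp (fun x => G x i j) 2 (volume.restrict Ω)
  weak_deriv : ∀ (i j : Fin 2) (ψ : Plane → ℝ), IsTestFunction Ω ψ →
    ∫ x in Ω, u x i * partialDeriv j ψ x = - ∫ x in Ω, G x i j * ψ x

/-- The admissible functions `ρ`: smooth on `ℝ`, zero on `(-∞, 0]`, convex on `[0, s₀]`,
and equal to `γ s + κ` on `[s₀, ∞)`. -/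
structure IsAdmissibleRho (γ s₀ κ : ℝ) (ρ : ℝ → ℝ) : Prop where
  smooth : ContDiff ℝ ∞ ρ
  eq_zero : ∀ s ≤ 0, ρ s = 0
  convex : ConvexOn ℝ (Set.Icc 0 s₀) ρ
  eq_affine : ∀ s, s₀ ≤ s → ρ s = γ * s + κ

/-- The weak Euler–Lagrange equation of `∫_Ω ½|∇u|² + ρ(det ∇u)`, for the weak gradient
`G = ∇u`: `∫_Ω (∇u + ρ'(det ∇u) cof ∇u) · ∇φ = 0` for all `φ ∈ C_c^∞(Ω, ℝ²)`. -/
def WeakEulerLagrange (Ω : Set Plane) (ρ : ℝ → ℝ) (G : Plane → Mat2) : Prop :=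
  ∀ φ : Plane → Plane, IsTestFunction Ω φ →
    ∫ x in Ω, frobInner (G x + deriv ρ (G x).det • cof (G x)) (gradMatrix φ x) = 0

/-- The `L²` class of `u` on `Ω` belongs to `C^{0,α}_loc(Ω, ℝ²)`: it has a representative
that is Hölder continuous with exponent `α` on every compact subset of `Ω`. -/
def IsLocallyHolder (Ω : Set Plane) (α : ℝ≥0) (u : Plane → Plane) : Prop :=
  ∃ v : Plane → Plane, v =ᵐ[volume.restrict Ω] u ∧
    ∀ K : Set Plane, IsCompact K → K ⊆ Ω → ∃ C : ℝ≥0, HolderOnWith C α v K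

/-! Write F = ∇u + ρ'(det ∇u) cof ∇u for the stress. For 2 × 2 matrices A · cof A = 2 det A and |cof
A| = |A|. Convexity on [0, s₀] makes ρ' increase from 0 to γ there, so 0 ≤ ρ' ≤ γ everywhere, and
ρ'(s) s ≥ 0 because ρ' vanishes for s ≤ 0. Hence F · ∇u ≥ |∇u|² and |F|² ≤ 2(1 + γ²)|∇u|² pointwise:
along the solution itself the equation div F = 0 behaves like a uniformly elliptic system. No
monotonicity of the stress as a function of the matrix is needed.

The regularity then comes from Widman's hole filling. Testing with η(u - c), where η = 1 on a ball
of radius R, bounds the Dirichlet integral on this ball by terms living only on the surrounding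
annulus, where ∇η lives. With c from the Poincaré inequality on the annulus (`poincare_annulus`),
these terms are at most K times the Dirichlet integral over the annulus (`hole_filling`). Adding K
times the integral over the hole to both sides gives decay by the factor K/(K + 1) from one scale to
the next. In dimension two this geometric decay is exactly what Morrey's argument needs: averages
over shrinking balls converge geometrically, and the limit is a Hölder representative
(`exists_holder_of_decay`).

The analysis is carried out on ℝ × ℝ with the sup norm, whose balls are squares. An annulus is then
a union of four rectangles, and on rectangles the Poincaré inequality follows from one-dimensional
calculus and Fubini. Mollification justifies the non-smooth test function η(u - c) and extends the
Poincaré inequality from smooth to weakly differentiable functions. -/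

/-! ### Mollification in L². -/

section Mollification

open Filter Topology Convolution

variable {E : Type*} [NormedAddCommGroup E] [NormedSpace ℝ E] [FiniteDimensional ℝ E]
  [MeasurableSpace E] [BorelSpace E] {μ : Measure E} [μ.IsAddHaarMeasure]

/-- Translations are continuous in `L²`. -/
theorem tendsto_eLpNorm_translate_sub {f : E → ℝ} (hf : MemLp f 2 μ) :
    Tendsto (fun y => eLpNorm (fun x => f (x - y) - f x) 2 μ) (𝓝 0) (𝓝 0) := by
  have : Fact ((2 : ENNReal) ≠ ⊤) := ⟨by norm_num⟩
  -- The translation group acts continuously on L²; the rest only unfolds this action.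
  have hcont : Continuous fun y : E => DomAddAct.mk (-y) +ᵥ hf.toLp f := by
    have h1 : Continuous fun y : E => DomAddAct.mk (-y) :=
      (DomAddAct.mkHomeomorph (M := E)).continuous.comp continuous_neg
    exact h1.vadd continuous_const
  have h0 := hcont.tendsto 0
  simp only [DomAddAct.mk_vadd_toLp] at h0
  have h2 : ∀ y : E, MemLp (fun x => f (-y +ᵥ x)) 2 μ := fun y =>
    hf.comp_measurePreserving (measurePreserving_vadd (-y) μ)
  have h3 := (Lp.tendsto_Lp_iff_tendsto_eLpNorm'' (fun y : E => fun x => f (-y +ᵥ x)) h2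
    (fun x => f (-(0 : E) +ᵥ x)) (h2 0)).1 h0
  refine h3.congr fun y => ?_
  congr 1
  ext x
  simp [sub_eq_neg_add]

/-- Jensen's inequality for the square of a weighted lower integral with weight of mass one. -/
theorem sq_lintegral_mul_le {α : Type*} [MeasurableSpace α] {ν : Measure α} {w h : α → ENNReal}
    (hw : Measurable w) (hw1 : ∫⁻ y, w y ∂ν = 1) (hh : AEMeasurable h ν) :
    (∫⁻ y, w y * h y ∂ν) ^ 2 ≤ ∫⁻ y, w y * h y ^ 2 ∂ν := by
  -- Hölder with p = q = 2 for the pair h, 1 with respect to the probability measure of density w.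
  have key := ENNReal.lintegral_mul_le_Lp_mul_Lq (ν.withDensity w)
    (p := 2) (q := 2) (by constructor <;> norm_num) (f := h) (g := fun _ => 1)
    (hh.mono_ac (withDensity_absolutelyContinuous _ _)) aemeasurable_const
  have hu : ν.withDensity w Set.univ = 1 := by simp [hw1]
  simp only [Pi.mul_apply, mul_one, ENNReal.one_rpow, lintegral_const, hu] at key
  rw [lintegral_withDensity_eq_lintegral_mul₀ hw.aemeasurable hh,
    lintegral_withDensity_eq_lintegral_mul₀ hw.aemeasurable (hh.pow_const _)] at key
  simp only [Pi.mul_apply, ENNReal.rpow_two] at key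
  calc _ ≤ ((∫⁻ y, w y * h y ^ 2 ∂ν) ^ (1 / 2 : ℝ)) ^ 2 := by gcongr
    _ = _ := by
      rw [← ENNReal.rpow_two, ← ENNReal.rpow_mul]; norm_num

/-- Mollifications of an `L²` function converge to it in `L²`. -/
theorem tendsto_eLpNorm_mollify_sub {φ : ℕ → ContDiffBump (0 : E)}
    (hφ : Tendsto (fun n => (φ n).rOut) atTop (𝓝 0)) {f : E → ℝ} (hf : MemLp f 2 μ) :
    Tendsto (fun n => eLpNorm (((φ n).normed μ ⋆[ContinuousLinearMap.lsmul ℝ ℝ, μ] f) - f) 2 μ)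
      atTop (𝓝 0) := by
  have hloc : LocallyIntegrable f μ := hf.locallyIntegrable (by norm_num)
  rw [ENNReal.tendsto_nhds_zero]
  intro ε hε
  have htr := (ENNReal.tendsto_nhds_zero.1 (tendsto_eLpNorm_translate_sub hf)) ε hε
  obtain ⟨δ, hδ, hball⟩ := Metric.eventually_nhds_iff_ball.1 htr
  filter_upwards [hφ.eventually (gt_mem_nhds hδ)] with n hn
  set w : E → ENNReal := fun y => ENNReal.ofReal ((φ n).normed μ y) with hw
  have hwm : Measurable w := ((φ n).continuous_normed (μ := μ)).measurable.ennreal_ofReal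
  have hnn : ∀ y, 0 ≤ (φ n).normed μ y := (φ n).nonneg_normed
  have hw1 : ∫⁻ y, w y ∂μ = 1 := by
    rw [hw, ← ofReal_integral_eq_lintegral_ofReal (φ n).integrable_normed
      (ae_of_all _ hnn), (φ n).integral_normed, ENNReal.ofReal_one]
  have hsw : ∀ x, AEMeasurable (fun y => ‖f (x - y) - f x‖ₑ) μ := fun x =>
    ((hf.aestronglyMeasurable.comp_quasiMeasurePreserving
      (quasiMeasurePreserving_sub_left μ x)).sub aestronglyMeasurable_const).enorm
  have hpt : ∀ x, ‖((φ n).normed μ ⋆[ContinuousLinearMap.lsmul ℝ ℝ, μ] f) x - f x‖ₑ ^ 2 ≤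
      ∫⁻ y, w y * ‖f (x - y) - f x‖ₑ ^ 2 ∂μ := by
    intro x
    have hex := ((φ n).hasCompactSupport_normed (μ := μ)).convolutionExists_left
      (ContinuousLinearMap.lsmul ℝ ℝ) (φ n).continuous_normed hloc x (μ := μ)
    have heq : ((φ n).normed μ ⋆[ContinuousLinearMap.lsmul ℝ ℝ, μ] f) x - f x =
        ∫ y, (φ n).normed μ y * (f (x - y) - f x) ∂μ := by
      have h1 : f x = ∫ y, (φ n).normed μ y * f x ∂μ := by
        rw [integral_mul_const, (φ n).integral_normed, one_mul]
      conv_lhs => rw [h1]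
      rw [convolution_def, ← integral_sub hex.integrable
        ((φ n).integrable_normed.mul_const _)]
      simp [mul_sub]
    rw [heq]
    refine le_trans ?_ (sq_lintegral_mul_le hwm hw1 (hsw x))
    gcongr
    refine (enorm_integral_le_lintegral_enorm _).trans (le_of_eq ?_)
    congr 1
    ext y
    rw [enorm_mul, Real.enorm_of_nonneg (hnn y)]
  rw [eLpNorm_eq_lintegral_rpow_enorm_toReal (by norm_num) (by norm_num)]
  have hjoint : AEMeasurable (Function.uncurry fun x y => w y * ‖f (x - y) - f x‖ₑ ^ 2)
      (μ.prod μ) := by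
    refine AEMeasurable.mul (hwm.comp measurable_snd).aemeasurable ?_
    refine AEMeasurable.pow_const (AEStronglyMeasurable.enorm ?_) _
    exact (hf.aestronglyMeasurable.comp_quasiMeasurePreserving
      (quasiMeasurePreserving_sub_of_right_invariant μ μ)).sub
      (hf.aestronglyMeasurable.comp_quasiMeasurePreserving Measure.quasiMeasurePreserving_fst)
  have htot : ∫⁻ x, ‖((φ n).normed μ ⋆[ContinuousLinearMap.lsmul ℝ ℝ, μ] f) x - f x‖ₑ ^ 2 ∂μ
      ≤ ε ^ 2 := by
    calc _ ≤ ∫⁻ x, ∫⁻ y, w y * ‖f (x - y) - f x‖ₑ ^ 2 ∂μ ∂μ := lintegral_mono hpt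
      _ = ∫⁻ y, ∫⁻ x, w y * ‖f (x - y) - f x‖ₑ ^ 2 ∂μ ∂μ := lintegral_lintegral_swap hjoint
      _ ≤ ∫⁻ y, w y * ε ^ 2 ∂μ := by
        refine lintegral_mono fun y => ?_
        rw [lintegral_const_mul' _ _ ENNReal.ofReal_ne_top]
        -- For small shifts the translation error is at most ε; for the others the kernel vanishes.
        by_cases hy : y ∈ Metric.ball (0 : E) δ
        · gcongr
          have := hball y hy
          rw [eLpNorm_eq_lintegral_rpow_enorm_toReal (by norm_num) (by norm_num)] at this
          calc _ = ((∫⁻ x, ‖f (x - y) - f x‖ₑ ^ 2 ∂μ) ^ (1 / 2 : ℝ)) ^ 2 := by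
                rw [← ENNReal.rpow_two, ← ENNReal.rpow_mul]; norm_num
            _ ≤ ε ^ 2 := by gcongr; simpa using this
        · have : (φ n).normed μ y = 0 := by
            rw [← Function.notMem_support, (φ n).support_normed_eq]
            exact fun h => hy (Metric.ball_subset_ball hn.le h)
          simp [hw, this]
      _ = ε ^ 2 := by rw [lintegral_mul_const _ hwm, hw1, one_mul]
  calc _ ≤ (ε ^ 2) ^ (1 / 2 : ℝ) := by
        simp only [Pi.sub_apply, ENNReal.toReal_ofNat, ENNReal.rpow_two]; gcongr
    _ = ε := by rw [← ENNReal.rpow_two, ← ENNReal.rpow_mul]; norm_num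

end Mollification

/-! ### Weak gradients, cutoffs and admissible test functions. -/

section WeakGradient

open Filter Topology Convolution

/-- The standard basis of `ℝ × ℝ`. -/
def axis : Fin 2 → ℝ × ℝ := ![(1, 0), (0, 1)]

/-- The `j`-th partial derivative of a scalar function on `ℝ × ℝ`. -/
noncomputable def pd (j : Fin 2) (ψ : ℝ × ℝ → ℝ) (x : ℝ × ℝ) : ℝ := fderiv ℝ ψ x (axis j)

/-- Smooth functions with compact support in `Ω`. -/
structure IsTestOn (Ω : Set (ℝ × ℝ)) (ψ : ℝ × ℝ → ℝ) : Prop where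
  smooth : ContDiff ℝ ∞ ψ
  compact : HasCompactSupport ψ
  support_subset : tsupport ψ ⊆ Ω

/-- `u` has weak gradient `g` on `Ω`, both being given as square integrable functions on the
whole plane. -/
structure HasWeakGrad (Ω : Set (ℝ × ℝ)) (u : ℝ × ℝ → ℝ) (g : Fin 2 → ℝ × ℝ → ℝ) : Prop where
  memLp : MemLp u 2
  memLp_grad : ∀ j, MemLp (g j) 2
  weak : ∀ j ψ, IsTestOn Ω ψ → ∫ x, u x * pd j ψ x = -∫ x, g j x * ψ x

/-- The vector field `F` is weakly divergence free on `Ω`. -/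
def IsWeakDivFree (Ω : Set (ℝ × ℝ)) (F : Fin 2 → ℝ × ℝ → ℝ) : Prop :=
  ∀ ψ, IsTestOn Ω ψ → ∫ x, ∑ j, F j x * pd j ψ x = 0

variable {Ω : Set (ℝ × ℝ)} {u η ψ w : ℝ × ℝ → ℝ} {g F : Fin 2 → ℝ × ℝ → ℝ}

theorem continuous_pd (hψ : ContDiff ℝ ∞ ψ) (j : Fin 2) : Continuous (pd j ψ) :=
  (hψ.continuous_fderiv (by norm_num)).clm_apply continuous_const

theorem hasCompactSupport_pd (hψ : HasCompactSupport ψ) (j : Fin 2) :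
    HasCompactSupport (pd j ψ) :=
  (hψ.fderiv ℝ).comp_left (g := fun A : ℝ × ℝ →L[ℝ] ℝ => A (axis j)) (by simp)

theorem pd_eq_zero_of_notMem {x : ℝ × ℝ} (hx : x ∉ tsupport ψ) (j : Fin 2) : pd j ψ x = 0 := by
  have : fderiv ℝ ψ x = 0 := by
    by_contra h
    exact hx (support_fderiv_subset ℝ h)
  simp [pd, this]

theorem pd_mul (hη : ContDiff ℝ ∞ η) (hψ : ContDiff ℝ ∞ ψ) (j : Fin 2) (x : ℝ × ℝ) :
    pd j (fun y => η y * ψ y) x = η x * pd j ψ x + ψ x * pd j η x := by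
  simp only [pd]
  rw [fderiv_fun_mul (hη.differentiable (by norm_num) x) (hψ.differentiable (by norm_num) x)]
  simp

theorem IsTestOn.memLp (h : IsTestOn Ω ψ) : MemLp ψ 2 :=
  h.smooth.continuous.memLp_of_hasCompactSupport h.compact

theorem IsTestOn.memLp_pd (h : IsTestOn Ω ψ) (j : Fin 2) : MemLp (pd j ψ) 2 :=
  (continuous_pd h.smooth j).memLp_of_hasCompactSupport (hasCompactSupport_pd h.compact j)

theorem IsTestOn.mono {Ω' : Set (ℝ × ℝ)} (h : IsTestOn Ω ψ) (hs : Ω ⊆ Ω') : IsTestOn Ω' ψ :=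
  ⟨h.smooth, h.compact, h.support_subset.trans hs⟩

theorem memLp_continuous_mul {f k : ℝ × ℝ → ℝ} (hf : MemLp f 2) (hk : Continuous k)
    (hc : HasCompactSupport k) : MemLp (fun x => k x * f x) 2 :=
  hf.mul (hk.memLp_top_of_hasCompactSupport hc volume)

theorem IsTestOn.mul_left (hη : IsTestOn Ω η) (hψ : ContDiff ℝ ∞ ψ) :
    IsTestOn Ω (fun x => η x * ψ x) :=
  ⟨hη.smooth.mul hψ, hη.compact.mul_right,
    (tsupport_mul_subset_left (f := η) (g := ψ)).trans hη.support_subset⟩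

/-- Product rule for the product of a test function and a weakly differentiable function. -/
theorem HasWeakGrad.cutoff (hu : HasWeakGrad Ω u g) (hη : IsTestOn Ω η) :
    HasWeakGrad Set.univ (fun x => η x * u x) (fun j x => η x * g j x + u x * pd j η x) := by
  have hηc := hη.smooth.continuous
  refine ⟨memLp_continuous_mul hu.memLp hηc hη.compact, fun j => ?_, fun j ψ hψ => ?_⟩
  · refine (memLp_continuous_mul (hu.memLp_grad j) hηc hη.compact).add ?_
    simpa only [mul_comm] using
      memLp_continuous_mul hu.memLp (continuous_pd hη.smooth j) (hasCompactSupport_pd hη.compact j)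
  · have hηψ : IsTestOn Ω (fun x => η x * ψ x) := hη.mul_left hψ.smooth
    have h1 := hu.weak j _ hηψ
    have h2 : ∀ x, η x * u x * pd j ψ x =
        u x * pd j (fun x => η x * ψ x) x - u x * (ψ x * pd j η x) := fun x => by
      rw [pd_mul hη.smooth hψ.smooth]; ring
    have i1 : Integrable (fun x => u x * pd j (fun x => η x * ψ x) x) :=
      hu.memLp.integrable_mul (hηψ.memLp_pd j)
    have i2 : Integrable (fun x => u x * (ψ x * pd j η x)) :=
      hu.memLp.integrable_mul
        (memLp_continuous_mul (hη.memLp_pd j) hψ.smooth.continuous hψ.compact)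
    have i3 : Integrable (fun x => g j x * (η x * ψ x)) :=
      (hu.memLp_grad j).integrable_mul hηψ.memLp
    simp_rw [h2]
    rw [integral_sub i1 i2, h1, ← neg_add', ← integral_add i3 i2]
    congr 2
    ext x
    ring

theorem integrable_mul_memLp {f k : ℝ × ℝ → ℝ} {ν : Measure (ℝ × ℝ)} (hf : MemLp f 2 ν)
    (hk : MemLp k 2 ν) : Integrable (fun x => f x * k x) ν := hf.integrable_mul hk

/-- Integrals of products are continuous under `L²` convergence of the factors. -/
theorem tendsto_integral_mul {ν : Measure (ℝ × ℝ)} {f k : ℕ → ℝ × ℝ → ℝ} {f₀ k₀ : ℝ × ℝ → ℝ}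
    (hf : ∀ n, MemLp (f n) 2 ν) (hf₀ : MemLp f₀ 2 ν) (hk : ∀ n, MemLp (k n) 2 ν)
    (hk₀ : MemLp k₀ 2 ν) (hft : Tendsto (fun n => eLpNorm (f n - f₀) 2 ν) atTop (𝓝 0))
    (hkt : Tendsto (fun n => eLpNorm (k n - k₀) 2 ν) atTop (𝓝 0)) :
    Tendsto (fun n => ∫ x, f n x * k n x ∂ν) atTop (𝓝 (∫ x, f₀ x * k₀ x ∂ν)) := by
  have key : ∀ {a b : ℝ × ℝ → ℝ} (ha : MemLp a 2 ν) (hb : MemLp b 2 ν),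
      ∫ x, a x * b x ∂ν = inner ℝ (ha.toLp a) (hb.toLp b) := fun ha hb => by
    rw [L2.inner_def]
    refine integral_congr_ae ?_
    filter_upwards [ha.coeFn_toLp, hb.coeFn_toLp] with x h1 h2
    simp [h1, h2, mul_comm]
  rw [key hf₀ hk₀]
  refine Tendsto.congr (fun n => (key (hf n) (hk n)).symm) ?_
  exact ((Lp.tendsto_Lp_iff_tendsto_eLpNorm'' f hf f₀ hf₀).2 hft).inner
    ((Lp.tendsto_Lp_iff_tendsto_eLpNorm'' k hk k₀ hk₀).2 hkt)

/-- Mollification commutes with weak differentiation. -/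
theorem pd_convolution (hw : HasWeakGrad Set.univ w g) {k : ℝ × ℝ → ℝ}
    (hk : ContDiff ℝ ∞ k) (hkc : HasCompactSupport k) (j : Fin 2) :
    pd j (k ⋆[ContinuousLinearMap.lsmul ℝ ℝ, volume] w) =
      k ⋆[ContinuousLinearMap.lsmul ℝ ℝ, volume] g j := by
  ext x
  have hloc : LocallyIntegrable w := hw.memLp.locallyIntegrable (by norm_num)
  have h1 := hkc.hasFDerivAt_convolution_left (ContinuousLinearMap.lsmul ℝ ℝ)
    (hk.of_le (by norm_num)) hloc x
  have hex := (hkc.fderiv ℝ).convolutionExists_left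
    ((ContinuousLinearMap.lsmul ℝ ℝ : ℝ →L[ℝ] ℝ →L[ℝ] ℝ).precompL (ℝ × ℝ))
    (hk.continuous_fderiv (by norm_num)) hloc x
  have h2 : pd j (k ⋆[ContinuousLinearMap.lsmul ℝ ℝ, volume] w) x =
      ∫ t, pd j k t * w (x - t) := by
    rw [pd, h1.fderiv, convolution_def, ContinuousLinearMap.integral_apply hex.integrable]
    rfl
  -- The reflected kernel is the test function: its derivative carries a minus sign that cancels the
  -- one in the definition of the weak gradient.
  have hrefl : IsTestOn Set.univ (fun s => k (x - s)) :=
    ⟨hk.comp (contDiff_const.sub contDiff_id),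
      hkc.comp_homeomorph (Homeomorph.subLeft x), Set.subset_univ _⟩
  have h3 : ∀ s, pd j (fun s => k (x - s)) s = - pd j k (x - s) := fun s => by
    have := ((hk.differentiable (by norm_num)) (x - s)).hasFDerivAt.comp s
      ((hasFDerivAt_id s).const_sub x)
    simp only [pd]
    rw [show (fun s => k (x - s)) = k ∘ HSub.hSub x from rfl, this.fderiv]
    simp
  have h4 := hw.weak j _ hrefl
  rw [h2, ← integral_sub_left_eq_self (fun t => pd j k t * w (x - t)) volume x,
    convolution_eq_swap]
  simp only [h3, mul_neg, integral_neg, neg_inj, sub_sub_cancel] at h4 ⊢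
  simp only [ContinuousLinearMap.lsmul_apply, smul_eq_mul]
  simpa only [mul_comm] using h4

/-- A weakly differentiable function with compact support is the limit of test functions in the
norm of `W^{1,2}`. -/
theorem HasWeakGrad.exists_approx (hw : HasWeakGrad Set.univ w g) {K : Set (ℝ × ℝ)}
    (hK : IsCompact K) (hwK : ∀ x ∉ K, w x = 0) (hΩ : IsOpen Ω) (hKΩ : K ⊆ Ω) :
    ∃ ψ : ℕ → ℝ × ℝ → ℝ, (∀ n, IsTestOn Ω (ψ n)) ∧
      Tendsto (fun n => eLpNorm (ψ n - w) 2) atTop (𝓝 0) ∧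
      ∀ j, Tendsto (fun n => eLpNorm (pd j (ψ n) - g j) 2) atTop (𝓝 0) := by
  obtain ⟨δ, hδ, hth⟩ := hK.exists_cthickening_subset_open hΩ hKΩ
  -- Outer radii at most δ keep every mollification supported in the δ-thickening of K, hence in Ω.
  let φ : ℕ → ContDiffBump (0 : ℝ × ℝ) := fun n =>
    ⟨δ / (n + 1) / 2, δ / (n + 1), by positivity, half_lt_self (by positivity)⟩
  have hφ : Tendsto (fun n => (φ n).rOut) atTop (𝓝 0) :=
    tendsto_const_div_atTop_nhds_zero_nat δ |>.comp (tendsto_add_atTop_nat 1) |>.congr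
      fun n => by simp [φ]
  have hloc : LocallyIntegrable w := hw.memLp.locallyIntegrable (by norm_num)
  have hsupp : ∀ n, tsupport ((φ n).normed volume ⋆[ContinuousLinearMap.lsmul ℝ ℝ, volume] w) ⊆
      Metric.cthickening δ K := fun n => by
    refine closure_minimal ?_ Metric.isClosed_cthickening
    refine (support_convolution_subset _).trans ?_
    rw [(φ n).support_normed_eq]
    rintro _ ⟨a, ha, b, hb, rfl⟩
    have hbK : b ∈ K := by
      by_contra h
      exact hb (hwK b h)
    refine Metric.mem_cthickening_of_dist_le _ b _ _ hbK ?_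
    rw [mem_ball_zero_iff] at ha
    have : (φ n).rOut ≤ δ := div_le_self hδ.le (by linarith [n.cast_nonneg (α := ℝ)])
    simpa using ha.le.trans this
  refine ⟨fun n => (φ n).normed volume ⋆[ContinuousLinearMap.lsmul ℝ ℝ, volume] w,
    fun n => ⟨?_, ?_, (hsupp n).trans hth⟩, tendsto_eLpNorm_mollify_sub hφ hw.memLp, fun j => ?_⟩
  · exact (φ n).hasCompactSupport_normed.contDiff_convolution_left _
      (φ n).contDiff_normed hloc
  · exact hK.cthickening.of_isClosed_subset (isClosed_tsupport _) (hsupp n)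
  · simp_rw [fun n => pd_convolution hw ((φ n).contDiff_normed (μ := volume) (n := ⊤))
      (φ n).hasCompactSupport_normed j]
    exact tendsto_eLpNorm_mollify_sub hφ (hw.memLp_grad j)

/-- A weakly divergence free field may be tested with the product of a test function and a weakly
differentiable function. -/
theorem IsWeakDivFree.integral_cutoff (hF : IsWeakDivFree Ω F) (hF2 : ∀ j, MemLp (F j) 2)
    (hΩ : IsOpen Ω) (hu : HasWeakGrad Ω u g) (hη : IsTestOn Ω η) :
    ∫ x, ∑ j, F j x * (η x * g j x + u x * pd j η x) = 0 := by
  have hw := hu.cutoff hη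
  obtain ⟨ψ, hψ, -, hlim⟩ := hw.exists_approx hη.compact
    (fun x hx => by simp [image_eq_zero_of_notMem_tsupport hx]) hΩ hη.support_subset
  rw [integral_finsetSum _ fun j _ => integrable_mul_memLp (hF2 j) (hw.memLp_grad j)]
  have h1 : Tendsto (fun n => ∑ j, ∫ x, F j x * pd j (ψ n) x) atTop
      (𝓝 (∑ j, ∫ x, F j x * (η x * g j x + u x * pd j η x))) :=
    tendsto_finsetSum _ fun j _ => tendsto_integral_mul (fun _ => hF2 j) (hF2 j)
      (fun n => (hψ n).memLp_pd j) (hw.memLp_grad j) (by simp) (hlim j)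
  refine tendsto_nhds_unique h1 (tendsto_const_nhds.congr fun n => ?_)
  rw [← integral_finsetSum _ fun j _ => integrable_mul_memLp (hF2 j) ((hψ n).memLp_pd j)]
  exact (hF _ (hψ n)).symm

end WeakGradient

/-! ### Poincaré inequalities on rectangles. -/

section Poincare

open Filter Topology Set

/-- Cauchy–Schwarz against the constant 1, read off from ∫ (V f - I)² ≥ 0 with V the total mass and
I = ∫ f. Multiplying by V rather than dividing leaves only V = 0 as a separate case. -/
theorem sq_integral_le {α : Type*} [MeasurableSpace α] {ν : Measure α} [IsFiniteMeasure ν]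
    {f : α → ℝ} (hf : MemLp f 2 ν) :
    (∫ x, f x ∂ν) ^ 2 ≤ ν.real univ * ∫ x, f x ^ 2 ∂ν := by
  set V := ν.real univ
  set I := ∫ x, f x ∂ν with hI
  have h1 : Integrable f ν := hf.integrable (by norm_num)
  have h2 : Integrable (fun x => f x ^ 2) ν := hf.integrable_sq
  have key : ∫ x, (V * f x - I) ^ 2 ∂ν = V * (V * ∫ x, f x ^ 2 ∂ν - I ^ 2) := by
    have : ∀ x, (V * f x - I) ^ 2 = V ^ 2 * f x ^ 2 - (2 * V * I) * f x + I ^ 2 := fun x => by ring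
    simp_rw [this]
    have i1 : Integrable (fun x => V ^ 2 * f x ^ 2 - 2 * V * I * f x) ν :=
      (h2.const_mul _).sub (h1.const_mul _)
    rw [integral_add i1 (integrable_const _), integral_sub (h2.const_mul _) (h1.const_mul _), integral_const_mul, integral_const_mul,
      integral_const, smul_eq_mul]
    ring
  have hpos : 0 ≤ V * (V * ∫ x, f x ^ 2 ∂ν - I ^ 2) := key ▸ integral_nonneg fun x => sq_nonneg _
  rcases (measureReal_nonneg (μ := ν) (s := univ)).eq_or_lt with h0 | h0
  · have : ν = 0 := by
      rw [← Measure.measure_univ_eq_zero]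
      exact (measureReal_eq_zero_iff).1 h0.symm
    simp [hI, this]
  · nlinarith [nonneg_of_mul_nonneg_right hpos h0]

/-- The variance formula. -/
theorem setIntegral_sub_average_sq {α : Type*} [MeasurableSpace α] {ν : Measure α}
    [IsFiniteMeasure ν] {f : α → ℝ} (hf : MemLp f 2 ν) (hν : 0 < ν.real univ) :
    ∫ x, (f x - (∫ y, f y ∂ν) / ν.real univ) ^ 2 ∂ν =
      ∫ x, f x ^ 2 ∂ν - (∫ y, f y ∂ν) ^ 2 / ν.real univ := by
  set I := ∫ y, f y ∂ν with hI
  set V := ν.real univ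
  have h1 : Integrable f ν := hf.integrable (by norm_num)
  have h2 : Integrable (fun x => f x ^ 2) ν := hf.integrable_sq
  have : ∀ x, (f x - I / V) ^ 2 = f x ^ 2 - (2 * (I / V)) * f x + (I / V) ^ 2 := fun x => by ring
  simp_rw [this]
  have i1 : Integrable (fun x => f x ^ 2 - 2 * (I / V) * f x) ν := h2.sub (h1.const_mul _)
  rw [integral_add i1 (integrable_const _), integral_sub h2 (h1.const_mul _), integral_const_mul,
      integral_const, smul_eq_mul, ← hI]
  field_simp
  ring

theorem memLp_of_continuous_isCompact {X : Type*} [TopologicalSpace X] [MeasurableSpace X]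
    [OpensMeasurableSpace X] [R1Space X] {ν : Measure X} [IsFiniteMeasureOnCompacts ν] {f : X → ℝ}
    (hf : Continuous f) {s : Set X} (hs : IsCompact s) (hm : MeasurableSet s) :
    MemLp f 2 (ν.restrict s) := by
  rw [memLp_two_iff_integrable_sq (hf.continuousOn.aestronglyMeasurable_of_isCompact hs hm)]
  exact (hf.pow 2).continuousOn.integrableOn_compact' hs hm

/-- The fundamental theorem of calculus and Cauchy–Schwarz. Enlarging the domain to all of [a, b]
makes the bound independent of the two points, so that it can be integrated over them. -/
theorem sq_sub_le_integral_deriv {h h' : ℝ → ℝ} (hh : ∀ t, HasDerivAt h (h' t) t)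
    (hc : Continuous h') {a b x y : ℝ} (hx : x ∈ Icc a b) (hy : y ∈ Icc a b) :
    (h x - h y) ^ 2 ≤ (b - a) * ∫ t in Icc a b, h' t ^ 2 := by
  wlog hxy : y ≤ x generalizing x y
  · rw [← neg_sub, neg_sq]
    exact this hy hx (le_of_not_ge hxy)
  have hI : h x - h y = ∫ t in Ioc y x, h' t := by
    rw [← intervalIntegral.integral_of_le hxy,
      intervalIntegral.integral_eq_sub_of_hasDerivAt (fun t _ => hh t)
        (hc.intervalIntegrable _ _)]
  have hm : MemLp h' 2 (volume.restrict (Ioc y x)) :=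
    (memLp_of_continuous_isCompact hc isCompact_Icc measurableSet_Icc).mono_measure
      (Measure.restrict_mono Ioc_subset_Icc_self le_rfl)
  rw [hI]
  refine (sq_integral_le hm).trans ?_
  have h1 : (volume.restrict (Ioc y x)).real univ = x - y := by simp [hxy]
  rw [h1]
  have h2 : ∫ t in Ioc y x, h' t ^ 2 ≤ ∫ t in Icc a b, h' t ^ 2 :=
    setIntegral_mono_set ((hc.pow 2).continuousOn.integrableOn_compact isCompact_Icc)
      (ae_of_all _ fun _ => sq_nonneg _)
      (Eventually.of_forall fun t ht => ⟨hy.1.trans ht.1.le, ht.2.trans hx.2⟩)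
  have h3 : 0 ≤ ∫ t in Ioc y x, h' t ^ 2 := integral_nonneg fun _ => sq_nonneg _
  nlinarith [hx.2, hy.1]

theorem hasDerivAt_fst {f : ℝ × ℝ → ℝ} (hf : ContDiff ℝ ∞ f) (y t : ℝ) :
    HasDerivAt (fun s => f (s, y)) (pd 0 f (t, y)) t := by
  have h1 := (hf.differentiable (by norm_num) (t, y)).hasFDerivAt
  have h2 : HasDerivAt (fun s : ℝ => (s, y)) ((1 : ℝ), (0 : ℝ)) t :=
    (hasDerivAt_id t).prodMk (hasDerivAt_const t y)
  exact h1.comp_hasDerivAt t h2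

theorem hasDerivAt_snd {f : ℝ × ℝ → ℝ} (hf : ContDiff ℝ ∞ f) (x t : ℝ) :
    HasDerivAt (fun s => f (x, s)) (pd 1 f (x, t)) t := by
  have h1 := (hf.differentiable (by norm_num) (x, t)).hasFDerivAt
  have h2 : HasDerivAt (fun s : ℝ => (x, s)) ((0 : ℝ), (1 : ℝ)) t :=
    (hasDerivAt_const t x).prodMk (hasDerivAt_id t)
  exact h1.comp_hasDerivAt t h2

variable {a b c d L : ℝ}

theorem measureReal_rect (hab : a ≤ b) (hcd : c ≤ d) :
    volume.real (Icc a b ×ˢ Icc c d) = (b - a) * (d - c) := by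
  rw [Measure.volume_eq_prod, measureReal_prod_prod]
  simp [hab, hcd]

theorem isCompact_rect : IsCompact (Icc a b ×ˢ Icc c d) := isCompact_Icc.prod isCompact_Icc

theorem setIntegral_rect_snd (hab : a ≤ b) (A : ℝ → ℝ) :
    ∫ p in Icc a b ×ˢ Icc c d, A p.2 = (b - a) * ∫ y in Icc c d, A y := by
  have := setIntegral_prod_mul (μ := (volume : Measure ℝ)) (ν := (volume : Measure ℝ))
    (fun _ => (1 : ℝ)) A (Icc a b) (Icc c d)
  simpa [hab, Measure.volume_eq_prod] using this

theorem setIntegral_rect_fst (hcd : c ≤ d) (A : ℝ → ℝ) :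
    ∫ p in Icc a b ×ˢ Icc c d, A p.1 = (d - c) * ∫ x in Icc a b, A x := by
  have := setIntegral_prod_mul (μ := (volume : Measure ℝ)) (ν := (volume : Measure ℝ))
    A (fun _ => (1 : ℝ)) (Icc a b) (Icc c d)
  simpa [hcd, Measure.volume_eq_prod, mul_comm] using this

/-- The Poincaré inequality on a rectangle for smooth functions. -/
theorem poincare_rect_smooth {f : ℝ × ℝ → ℝ} (hf : ContDiff ℝ ∞ f) (hab : a < b) (hcd : c < d)
    (hL1 : b - a ≤ L) (hL2 : d - c ≤ L) :
    ∫ p in Icc a b ×ˢ Icc c d, (f p - (∫ q in Icc a b ×ˢ Icc c d, f q) /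
        volume.real (Icc a b ×ˢ Icc c d)) ^ 2 ≤
      2 * L ^ 2 * ∑ j, ∫ p in Icc a b ×ˢ Icc c d, pd j f p ^ 2 := by
  set P := Icc a b ×ˢ Icc c d with hP
  set V := volume.real P with hV
  set m := (∫ q in P, f q) / V with hm
  have hPc : IsCompact P := isCompact_rect
  have hVeq : V = (b - a) * (d - c) := measureReal_rect hab.le hcd.le
  have hb : 0 < b - a := sub_pos.2 hab
  have hd : 0 < d - c := sub_pos.2 hcd
  have hV0 : 0 < V := hVeq ▸ mul_pos hb hd
  have : IsFiniteMeasure (volume.restrict P) := ⟨by simpa using hPc.measure_lt_top⟩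
  have hVu : (volume.restrict P).real univ = V := by simp [hV]
  have hint : ∀ {k : ℝ × ℝ → ℝ}, Continuous k → IntegrableOn k P := fun hk =>
    hk.continuousOn.integrableOn_compact hPc
  have hc0 : Continuous fun p => pd 0 f p ^ 2 := (continuous_pd hf 0).pow 2
  have hc1 : Continuous fun p => pd 1 f p ^ 2 := (continuous_pd hf 1).pow 2
  set X0 := ∫ p in P, pd 0 f p ^ 2 with hX0
  set X1 := ∫ p in P, pd 1 f p ^ 2 with hX1
  set A : ℝ → ℝ := fun y => ∫ t in Icc a b, pd 0 f (t, y) ^ 2 with hA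
  set B : ℝ → ℝ := fun x => ∫ t in Icc c d, pd 1 f (x, t) ^ 2 with hB
  have hAc : Continuous A :=
    continuous_parametric_integral_of_continuous (f := fun y t => pd 0 f (t, y) ^ 2)
      (hc0.comp continuous_swap) isCompact_Icc
  have hBc : Continuous B :=
    continuous_parametric_integral_of_continuous (f := fun x t => pd 1 f (x, t) ^ 2)
      hc1 isCompact_Icc
  have hA0 : ∀ y, 0 ≤ A y := fun y => integral_nonneg fun _ => sq_nonneg _
  have hB0 : ∀ y, 0 ≤ B y := fun y => integral_nonneg fun _ => sq_nonneg _
  have hX0A : ∫ y in Icc c d, A y = X0 := by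
    have h := hint hc0
    rw [hX0, Measure.volume_eq_prod, hP, ← setIntegral_prod_swap, setIntegral_prod]
    · rfl
    · exact h.swap
  have hX1B : ∫ x in Icc a b, B x = X1 := by
    rw [hX1, Measure.volume_eq_prod, hP, setIntegral_prod (fun p => pd 1 f p ^ 2) (hint hc1)]
  have hX0n : 0 ≤ X0 := integral_nonneg fun _ => sq_nonneg _
  have hX1n : 0 ≤ X1 := integral_nonneg fun _ => sq_nonneg _
  -- Pass from p to q through the corner (q.1, p.2). The horizontal leg costs a function of p.2
  -- alone and the vertical leg a function of q.1 alone, so the averages over q and p decouple.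
  have hdiff : ∀ p ∈ P, ∀ q ∈ P, (f p - f q) ^ 2 ≤ 2 * L * A p.2 + 2 * L * B q.1 := by
    intro p hp q hq
    have h1 := sq_sub_le_integral_deriv (fun t => hasDerivAt_fst hf p.2 t)
      ((continuous_pd hf 0).comp (by fun_prop)) hp.1 hq.1
    have h2 := sq_sub_le_integral_deriv (fun t => hasDerivAt_snd hf q.1 t)
      ((continuous_pd hf 1).comp (by fun_prop)) hp.2 hq.2
    have h3 : (b - a) * A p.2 ≤ L * A p.2 := mul_le_mul_of_nonneg_right hL1 (hA0 _)
    have h4 : (d - c) * B q.1 ≤ L * B q.1 := mul_le_mul_of_nonneg_right hL2 (hB0 _)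
    have h5 : (f (p.1, p.2) - f (q.1, p.2)) ^ 2 ≤ (b - a) * A p.2 := h1
    have h6 : (f (q.1, p.2) - f (q.1, q.2)) ^ 2 ≤ (d - c) * B q.1 := h2
    simp only [Prod.mk.eta] at h5 h6
    nlinarith [sq_nonneg ((f p - f (q.1, p.2)) - (f (q.1, p.2) - f q))]
  -- Average over q: V (f p - m) is the integral of f p - f q, to which Cauchy–Schwarz applies.
  have hpt : ∀ p ∈ P, (f p - m) ^ 2 ≤ 2 * L * A p.2 + 2 * L * (d - c) * X1 / V := by
    intro p hp
    have hk : Continuous fun q => f p - f q := continuous_const.sub hf.continuous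
    have h1 : ∫ q in P, (f p - f q) = V * (f p - m) := by
      rw [integral_sub (integrable_const _) (hint hf.continuous), integral_const, hVu, hm,
        smul_eq_mul]
      field_simp
    have h2 := sq_integral_le (ν := volume.restrict P)
      (memLp_of_continuous_isCompact hk hPc hPc.measurableSet)
    rw [h1, hVu] at h2
    have h3 : ∫ q in P, (f p - f q) ^ 2 ≤ ∫ q in P, (2 * L * A p.2 + 2 * L * B q.1) :=
      setIntegral_mono_on (hint (hk.pow 2))
        (hint (continuous_const.add (continuous_const.mul (hBc.comp continuous_fst))))
        hPc.measurableSet fun q hq => hdiff p hp q hq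
    have h4 : ∫ q in P, (2 * L * A p.2 + 2 * L * B q.1) =
        V * (2 * L * A p.2) + 2 * L * ((d - c) * X1) := by
      have i1 : IntegrableOn (fun q : ℝ × ℝ => 2 * L * B q.1) P :=
        hint (continuous_const.mul (hBc.comp continuous_fst))
      rw [integral_add (integrable_const _) i1, integral_const, hVu,
        integral_const_mul, setIntegral_rect_fst hcd.le, hX1B, smul_eq_mul]
    rw [h4] at h3
    have h5 : V * (V * (f p - m) ^ 2) ≤ V * (V * (2 * L * A p.2) + 2 * L * ((d - c) * X1)) := by
      nlinarith
    have h6 := le_of_mul_le_mul_left h5 hV0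
    have h7 : V * (2 * L * A p.2 + 2 * L * (d - c) * X1 / V) =
        V * (2 * L * A p.2) + 2 * L * ((d - c) * X1) := by field_simp
    exact le_of_mul_le_mul_left (h6.trans_eq h7.symm) hV0
  have hfin : ∫ p in P, (f p - m) ^ 2 ≤
      ∫ p in P, (2 * L * A p.2 + 2 * L * (d - c) * X1 / V) :=
    setIntegral_mono_on (hint ((hf.continuous.sub continuous_const).pow 2))
      (hint ((continuous_const.mul (hAc.comp continuous_snd)).add continuous_const))
      hPc.measurableSet hpt
  have heq : ∫ p in P, (2 * L * A p.2 + 2 * L * (d - c) * X1 / V) =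
      2 * L * ((b - a) * X0) + 2 * L * (d - c) * X1 := by
    have i1 : IntegrableOn (fun p : ℝ × ℝ => 2 * L * A p.2) P :=
      hint (continuous_const.mul (hAc.comp continuous_snd))
    rw [integral_add i1 (integrable_const _), integral_const, hVu, integral_const_mul,
      setIntegral_rect_snd hab.le, hX0A, smul_eq_mul]
    field_simp
  rw [Fin.sum_univ_two]
  have hL0 : 0 ≤ L := hb.le.trans hL1
  have e1 : (b - a) * X0 ≤ L * X0 := mul_le_mul_of_nonneg_right hL1 hX0n
  have e2 : (d - c) * X1 ≤ L * X1 := mul_le_mul_of_nonneg_right hL2 hX1n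
  nlinarith [mul_le_mul_of_nonneg_left e1 hL0, mul_le_mul_of_nonneg_left e2 hL0]

variable {Ω : Set (ℝ × ℝ)} {u w : ℝ × ℝ → ℝ} {g : Fin 2 → ℝ × ℝ → ℝ}

/-- The Poincaré inequality on a rectangle for compactly supported weakly differentiable
functions. -/
theorem poincare_rect_of_compact (hw : HasWeakGrad univ w g) {K : Set (ℝ × ℝ)}
    (hK : IsCompact K) (hwK : ∀ x ∉ K, w x = 0) (hab : a < b) (hcd : c < d)
    (hL1 : b - a ≤ L) (hL2 : d - c ≤ L) :
    ∫ p in Icc a b ×ˢ Icc c d, (w p - (∫ q in Icc a b ×ˢ Icc c d, w q) /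
        volume.real (Icc a b ×ˢ Icc c d)) ^ 2 ≤
      2 * L ^ 2 * ∑ j, ∫ p in Icc a b ×ˢ Icc c d, g j p ^ 2 := by
  obtain ⟨ψ, hψ, hlim, hlimg⟩ := hw.exists_approx hK hwK isOpen_univ (subset_univ _)
  have hP0 := fun n => poincare_rect_smooth (hψ n).smooth hab hcd hL1 hL2
  have hVeq := measureReal_rect hab.le hcd.le
  set P := Icc a b ×ˢ Icc c d with hP
  have hPc : IsCompact P := isCompact_rect
  have hfinite : IsFiniteMeasure (volume.restrict P) := ⟨by simpa using hPc.measure_lt_top⟩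
  have hVu : (volume.restrict P).real univ = volume.real P := by simp
  have hV0 : 0 < (volume.restrict P).real univ := by
    rw [hVu, hVeq]; exact mul_pos (sub_pos.2 hab) (sub_pos.2 hcd)
  have hres : ∀ {k : ℕ → ℝ × ℝ → ℝ}, Tendsto (fun n => eLpNorm (k n) 2) atTop (𝓝 0) →
      Tendsto (fun n => eLpNorm (k n) 2 (volume.restrict P)) atTop (𝓝 0) := fun h =>
    tendsto_of_tendsto_of_tendsto_of_le_of_le tendsto_const_nhds h (fun _ => zero_le)
      fun n => eLpNorm_mono_measure _ Measure.restrict_le_self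
  have hsq : ∀ {k : ℕ → ℝ × ℝ → ℝ} {k₀ : ℝ × ℝ → ℝ}, (∀ n, MemLp (k n) 2) → MemLp k₀ 2 →
      Tendsto (fun n => eLpNorm (k n - k₀) 2) atTop (𝓝 0) →
      Tendsto (fun n => ∫ x in P, k n x ^ 2) atTop (𝓝 (∫ x in P, k₀ x ^ 2)) := by
    intro k k₀ hk hk₀ h
    simp_rw [pow_two]
    exact tendsto_integral_mul (fun n => (hk n).restrict P) (hk₀.restrict P)
      (fun n => (hk n).restrict P) (hk₀.restrict P) (hres h) (hres h)
  have hI : Tendsto (fun n => ∫ x in P, ψ n x) atTop (𝓝 (∫ x in P, w x)) := by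
    have := tendsto_integral_mul (fun n => (hψ n).memLp.restrict P) (hw.memLp.restrict P)
      (fun _ => memLp_const (1 : ℝ)) (memLp_const (1 : ℝ)) (hres hlim)
      (by simp)
    simpa using this
  -- The variance formula expresses the left side through ∫ ψ² and ∫ ψ, both of which pass to the
  -- limit.
  have hleft := (hsq (fun n => (hψ n).memLp) hw.memLp hlim).sub
    ((hI.pow 2).div_const (volume.real P))
  have hright := (tendsto_finsetSum Finset.univ fun j _ =>
    hsq (fun n => (hψ n).memLp_pd j) (hw.memLp_grad j) (hlimg j)).const_mul (2 * L ^ 2)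
  have hkey := le_of_tendsto_of_tendsto hleft hright (Eventually.of_forall fun n => ?_)
  · have := setIntegral_sub_average_sq (hw.memLp.restrict P) hV0
    rw [hVu] at this
    rwa [this]
  · have h1 := setIntegral_sub_average_sq ((hψ n).memLp.restrict P) hV0
    rw [hVu] at h1
    have h2 := hP0 n
    rw [h1] at h2
    exact h2

/-- There is a smooth cutoff function between concentric squares. -/
theorem exists_isTestOn_ball {x : ℝ × ℝ} {r r' : ℝ} (hr : 0 < r) (hrr : r < r')
    (hΩ : Metric.closedBall x r' ⊆ Ω) :
    ∃ η, IsTestOn Ω η ∧ ∀ y ∈ Metric.ball x r, η y = 1 ∧ ∀ j, pd j η y = 0 := by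
  let φ : ContDiffBump x := ⟨r, r', hr, hrr⟩
  refine ⟨φ, ⟨φ.contDiff, φ.hasCompactSupport, by rwa [φ.tsupport_eq]⟩, fun y hy => ?_⟩
  have h1 : (φ : ℝ × ℝ → ℝ) =ᶠ[𝓝 y] fun _ => 1 := φ.eventuallyEq_one_of_mem_ball hy
  exact ⟨h1.self_of_nhds, fun j => by simp [pd, h1.fderiv_eq]⟩

/-- The Poincaré inequality on a rectangle for weakly differentiable functions. -/
theorem poincare_rect (hu : HasWeakGrad Ω u g) {x : ℝ × ℝ} {r r' : ℝ} (hr : 0 < r) (hrr : r < r')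
    (hΩ : Metric.closedBall x r' ⊆ Ω) (hP : Icc a b ×ˢ Icc c d ⊆ Metric.ball x r)
    (hab : a < b) (hcd : c < d) (hL1 : b - a ≤ L) (hL2 : d - c ≤ L) :
    ∫ p in Icc a b ×ˢ Icc c d, (u p - (∫ q in Icc a b ×ˢ Icc c d, u q) /
        volume.real (Icc a b ×ˢ Icc c d)) ^ 2 ≤
      2 * L ^ 2 * ∑ j, ∫ p in Icc a b ×ˢ Icc c d, g j p ^ 2 := by
  obtain ⟨η, hη, hη1⟩ := exists_isTestOn_ball hr hrr hΩ
  have h := poincare_rect_of_compact (hu.cutoff hη) hη.compact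
    (fun x hx => by simp [image_eq_zero_of_notMem_tsupport hx]) hab hcd hL1 hL2
  have hm : MeasurableSet (Icc a b ×ˢ Icc c d) := isCompact_rect.measurableSet
  have e1 : ∫ q in Icc a b ×ˢ Icc c d, η q * u q = ∫ q in Icc a b ×ˢ Icc c d, u q :=
    setIntegral_congr_fun hm fun q hq => by simp [(hη1 q (hP hq)).1]
  rw [e1] at h
  refine le_trans (le_of_eq ?_) (h.trans (le_of_eq ?_))
  · exact setIntegral_congr_fun hm fun q hq => by simp [(hη1 q (hP hq)).1]
  · congr 1
    refine Finset.sum_congr rfl fun j _ => ?_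
    exact setIntegral_congr_fun hm fun q hq => by
      simp [(hη1 q (hP hq)).1, (hη1 q (hP hq)).2 j]

end Poincare

/-! ### Poincaré inequality on annuli and hole filling. -/

section HoleFilling

open Filter Topology Set Metric

variable {Ω : Set (ℝ × ℝ)}

theorem integrableOn_sub_const_sq {u : ℝ × ℝ → ℝ} (hu : MemLp u 2) (c : ℝ) {A : Set (ℝ × ℝ)}
    (hA : volume A ≠ ⊤) : IntegrableOn (fun x => (u x - c) ^ 2) A := by
  have : IsFiniteMeasure (volume.restrict A) := ⟨by simpa using hA.lt_top⟩
  exact ((hu.restrict A).sub (memLp_const c)).integrable_sq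

/-- Gluing of two Poincaré inequalities on overlapping sets. -/
theorem setIntegral_sub_sq_union_le {u : ℝ × ℝ → ℝ} (hu : MemLp u 2) {A B S : Set (ℝ × ℝ)}
    (hA : volume A ≠ ⊤) (hB : volume B ≠ ⊤) (hSA : S ⊆ A) (hSB : S ⊆ B)
    (hBS : volume.real B ≤ 3 * volume.real S) {a b X Y : ℝ}
    (hX : ∫ x in A, (u x - a) ^ 2 ≤ X) (hY : ∫ x in B, (u x - b) ^ 2 ≤ Y) :
    ∫ x in A ∪ B, (u x - a) ^ 2 ≤ 13 * X + 14 * Y := by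
  have iA := integrableOn_sub_const_sq hu a hA
  have iB := integrableOn_sub_const_sq hu b hB
  have iB' := integrableOn_sub_const_sq hu a hB
  have hS : volume S ≠ ⊤ := measure_ne_top_of_subset hSA hA
  have hfB : IsFiniteMeasure (volume.restrict B) := ⟨by simpa using hB.lt_top⟩
  have hfS : IsFiniteMeasure (volume.restrict S) := ⟨by simpa using hS.lt_top⟩
  have iAS := iA.mono_set hSA
  have iBS := iB.mono_set hSB
  -- On the overlap both constants approximate u, which controls a - b. Changing b into a on B then
  -- costs 2Y + 6(2X + 2Y), and adding X for A gives 13X + 14Y.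
  have h1 : (a - b) ^ 2 * volume.real S ≤ 2 * X + 2 * Y := by
    calc (a - b) ^ 2 * volume.real S = ∫ _ in S, (a - b) ^ 2 := by
          simp [mul_comm]
      _ ≤ ∫ x in S, (2 * (u x - a) ^ 2 + 2 * (u x - b) ^ 2) := by
          refine integral_mono (integrable_const _) ((iAS.const_mul 2).add (iBS.const_mul 2))
            fun x => ?_
          nlinarith [sq_nonneg ((u x - a) + (u x - b))]
      _ = 2 * (∫ x in S, (u x - a) ^ 2) + 2 * ∫ x in S, (u x - b) ^ 2 := by
          rw [integral_add (iAS.const_mul 2) (iBS.const_mul 2), integral_const_mul,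
            integral_const_mul]
      _ ≤ 2 * X + 2 * Y := by
          have e1 : ∫ x in S, (u x - a) ^ 2 ≤ ∫ x in A, (u x - a) ^ 2 :=
            setIntegral_mono_set iA (ae_of_all _ fun _ => sq_nonneg _) hSA.eventuallyLE
          have e2 : ∫ x in S, (u x - b) ^ 2 ≤ ∫ x in B, (u x - b) ^ 2 :=
            setIntegral_mono_set iB (ae_of_all _ fun _ => sq_nonneg _) hSB.eventuallyLE
          linarith
  have h2 : ∫ x in B, (u x - a) ^ 2 ≤ 2 * Y + 2 * ((a - b) ^ 2 * volume.real B) := by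
    calc ∫ x in B, (u x - a) ^ 2 ≤ ∫ x in B, (2 * (u x - b) ^ 2 + 2 * (a - b) ^ 2) := by
          refine integral_mono iB' ((iB.const_mul 2).add (integrable_const _)) fun x => ?_
          nlinarith [sq_nonneg ((u x - b) + (a - b))]
      _ = 2 * (∫ x in B, (u x - b) ^ 2) + 2 * ((a - b) ^ 2 * volume.real B) := by
          rw [integral_add (iB.const_mul 2) (integrable_const _), integral_const_mul,
            integral_const]
          simp
          ring
      _ ≤ _ := by linarith
  have h3 : (a - b) ^ 2 * volume.real B ≤ (a - b) ^ 2 * (3 * volume.real S) :=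
    mul_le_mul_of_nonneg_left hBS (sq_nonneg _)
  have h4 : ∫ x in A ∪ B, (u x - a) ^ 2 ≤ (∫ x in A, (u x - a) ^ 2) + ∫ x in B, (u x - a) ^ 2 := by
    rw [← integral_add_measure iA iB']
    exact integral_mono_measure (Measure.restrict_union_le _ _)
      (ae_of_all _ fun _ => sq_nonneg _) (Integrable.add_measure iA iB')
  linarith

/-- The Poincaré inequality on a square annulus. -/
theorem poincare_annulus {u : ℝ × ℝ → ℝ} {g : Fin 2 → ℝ × ℝ → ℝ} (hu : HasWeakGrad Ω u g)
    {x : ℝ × ℝ} {R : ℝ} (hR : 0 < R) (hΩ : closedBall x (5 * R) ⊆ Ω) :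
    ∃ c, ∫ y in closedBall x (3 * R) \ ball x R, (u y - c) ^ 2 ≤
      342648 * R ^ 2 * ∑ j, ∫ y in closedBall x (3 * R) \ ball x R, g j y ^ 2 := by
  set A := closedBall x (3 * R) \ ball x R with hA
  set Γ := ∑ j, ∫ y in A, g j y ^ 2 with hΓ
  have hmemA : ∀ y : ℝ × ℝ, y ∈ A ↔ (x.1 - 3 * R ≤ y.1 ∧ y.1 ≤ x.1 + 3 * R) ∧
      (x.2 - 3 * R ≤ y.2 ∧ y.2 ≤ x.2 + 3 * R) ∧
      (y.1 ≤ x.1 - R ∨ x.1 + R ≤ y.1 ∨ y.2 ≤ x.2 - R ∨ x.2 + R ≤ y.2) := by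
    intro y
    simp only [hA, Set.mem_sdiff, mem_closedBall, mem_ball, Prod.dist_eq, Real.dist_eq, sup_le_iff,
      sup_lt_iff, abs_le, abs_lt, not_and_or, not_lt]
    constructor
    · rintro ⟨⟨⟨h1, h2⟩, h3, h4⟩, (h | h) | (h | h)⟩
      · exact ⟨by constructor <;> linarith, by constructor <;> linarith, Or.inl (by linarith)⟩
      · exact ⟨by constructor <;> linarith, by constructor <;> linarith,
          Or.inr (Or.inl (by linarith))⟩
      · exact ⟨by constructor <;> linarith, by constructor <;> linarith,
          Or.inr (Or.inr (Or.inl (by linarith)))⟩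
      · exact ⟨by constructor <;> linarith, by constructor <;> linarith,
          Or.inr (Or.inr (Or.inr (by linarith)))⟩
    · rintro ⟨⟨h1, h2⟩, ⟨h3, h4⟩, h | h | h | h⟩
      · exact ⟨⟨by constructor <;> linarith, by constructor <;> linarith⟩,
          Or.inl (Or.inl (by linarith))⟩
      · exact ⟨⟨by constructor <;> linarith, by constructor <;> linarith⟩,
          Or.inl (Or.inr (by linarith))⟩
      · exact ⟨⟨by constructor <;> linarith, by constructor <;> linarith⟩,
          Or.inr (Or.inl (by linarith))⟩
      · exact ⟨⟨by constructor <;> linarith, by constructor <;> linarith⟩,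
          Or.inr (Or.inr (by linarith))⟩
  -- Rectangles inside the annulus see only the gradient on the annulus; this is what leaves the
  -- hole out of the final bound. The outer radius 5R leaves room for the cutoff between 4R and 5R.
  have hrect : ∀ {a b c d : ℝ}, a < b → c < d → b - a ≤ 6 * R → d - c ≤ 6 * R →
      Icc a b ×ˢ Icc c d ⊆ A →
      ∃ m, ∫ y in Icc a b ×ˢ Icc c d, (u y - m) ^ 2 ≤ 72 * R ^ 2 * Γ := by
    intro a b c d hab hcd h1 h2 hsub
    refine ⟨_, (poincare_rect hu (x := x) (r := 4 * R) (r' := 5 * R) (by linarith) (by linarith)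
      hΩ ?_ hab hcd h1 h2).trans ?_⟩
    · exact (hsub.trans sdiff_subset).trans (closedBall_subset_ball (by linarith))
    · rw [show 2 * (6 * R) ^ 2 = 72 * R ^ 2 by ring]
      refine mul_le_mul_of_nonneg_left (Finset.sum_le_sum fun j _ => ?_) (by positivity)
      exact setIntegral_mono_set (hu.memLp_grad j).integrable_sq.integrableOn
        (ae_of_all _ fun _ => sq_nonneg _) hsub.eventuallyLE
  set P₀ := Icc (x.1 - 3 * R) (x.1 - R) ×ˢ Icc (x.2 - 3 * R) (x.2 + 3 * R) with hP₀
  set P₁ := Icc (x.1 - 3 * R) (x.1 + 3 * R) ×ˢ Icc (x.2 + R) (x.2 + 3 * R) with hP₁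
  set P₂ := Icc (x.1 + R) (x.1 + 3 * R) ×ˢ Icc (x.2 - 3 * R) (x.2 + 3 * R) with hP₂
  set P₃ := Icc (x.1 - 3 * R) (x.1 + 3 * R) ×ˢ Icc (x.2 - 3 * R) (x.2 - R) with hP₃
  obtain ⟨m₀, h₀⟩ := hrect (a := x.1 - 3 * R) (b := x.1 - R) (c := x.2 - 3 * R)
    (d := x.2 + 3 * R) (by linarith) (by linarith) (by linarith) (by linarith) (by
      rintro y ⟨⟨h1, h2⟩, h3, h4⟩
      exact (hmemA y).2 ⟨⟨h1, by linarith⟩, ⟨h3, h4⟩, Or.inl h2⟩)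
  obtain ⟨m₁, h₁⟩ := hrect (a := x.1 - 3 * R) (b := x.1 + 3 * R) (c := x.2 + R)
    (d := x.2 + 3 * R) (by linarith) (by linarith) (by linarith) (by linarith) (by
      rintro y ⟨⟨h1, h2⟩, h3, h4⟩
      exact (hmemA y).2 ⟨⟨h1, h2⟩, ⟨by linarith, h4⟩, Or.inr (Or.inr (Or.inr h3))⟩)
  obtain ⟨m₂, h₂⟩ := hrect (a := x.1 + R) (b := x.1 + 3 * R) (c := x.2 - 3 * R)
    (d := x.2 + 3 * R) (by linarith) (by linarith) (by linarith) (by linarith) (by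
      rintro y ⟨⟨h1, h2⟩, h3, h4⟩
      exact (hmemA y).2 ⟨⟨by linarith, h2⟩, ⟨h3, h4⟩, Or.inr (Or.inl h1)⟩)
  obtain ⟨m₃, h₃⟩ := hrect (a := x.1 - 3 * R) (b := x.1 + 3 * R) (c := x.2 - 3 * R)
    (d := x.2 - R) (by linarith) (by linarith) (by linarith) (by linarith) (by
      rintro y ⟨⟨h1, h2⟩, h3, h4⟩
      exact (hmemA y).2 ⟨⟨h1, h2⟩, ⟨h3, by linarith⟩, Or.inr (Or.inr (Or.inl h4))⟩)
  have hfin : ∀ {a b c d : ℝ}, volume (Icc a b ×ˢ Icc c d) ≠ ⊤ := fun {a b c d} =>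
    (isCompact_rect (a := a) (b := b) (c := c) (d := d)).measure_lt_top.ne
  -- The left, top, right and bottom strips are glued in turn. Each added 2R by 6R strip meets the
  -- previous ones in a corner square of side 2R, whence the volume ratio 3. Starting from 72R²Γ,
  -- the map X ↦ 13X + 14 · 72R²Γ applied three times yields 342648R²Γ.
  have k₁ := setIntegral_sub_sq_union_le hu.memLp hfin hfin
    (S := Icc (x.1 - 3 * R) (x.1 - R) ×ˢ Icc (x.2 + R) (x.2 + 3 * R))
    (Set.prod_mono le_rfl (Icc_subset_Icc (by linarith) le_rfl))
    (Set.prod_mono (Icc_subset_Icc le_rfl (by linarith)) le_rfl)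
    (by rw [measureReal_rect (by linarith) (by linarith),
          measureReal_rect (by linarith) (by linarith)]; nlinarith) h₀ h₁
  have k₂ := setIntegral_sub_sq_union_le hu.memLp (measure_union_ne_top hfin hfin) hfin
    (S := Icc (x.1 + R) (x.1 + 3 * R) ×ˢ Icc (x.2 + R) (x.2 + 3 * R))
    (subset_union_of_subset_right (Set.prod_mono (Icc_subset_Icc (by linarith) le_rfl) le_rfl) _)
    (Set.prod_mono le_rfl (Icc_subset_Icc (by linarith) le_rfl))
    (by rw [measureReal_rect (by linarith) (by linarith),
          measureReal_rect (by linarith) (by linarith)]; nlinarith) k₁ h₂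
  have k₃ := setIntegral_sub_sq_union_le hu.memLp
    (measure_union_ne_top (measure_union_ne_top hfin hfin) hfin) hfin
    (S := Icc (x.1 + R) (x.1 + 3 * R) ×ˢ Icc (x.2 - 3 * R) (x.2 - R))
    (subset_union_of_subset_right
      (Set.prod_mono le_rfl (Icc_subset_Icc le_rfl (by linarith))) _)
    (Set.prod_mono (Icc_subset_Icc (by linarith) le_rfl) le_rfl)
    (by rw [measureReal_rect (by linarith) (by linarith),
          measureReal_rect (by linarith) (by linarith)]; nlinarith) k₂ h₃
  refine ⟨m₀, le_trans (setIntegral_mono_set (integrableOn_sub_const_sq hu.memLp m₀ ?_)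
    (ae_of_all _ fun _ => sq_nonneg _) (LE.le.eventuallyLE fun y hy => ?_))
    (k₃.trans (le_of_eq (by ring)))⟩
  · exact measure_union_ne_top (measure_union_ne_top (measure_union_ne_top hfin hfin) hfin) hfin
  · obtain ⟨⟨h1, h2⟩, ⟨h3, h4⟩, h | h | h | h⟩ := (hmemA y).1 hy
    · exact Or.inl (Or.inl (Or.inl ⟨⟨h1, h⟩, h3, h4⟩))
    · exact Or.inl (Or.inr ⟨⟨h, h2⟩, h3, h4⟩)
    · exact Or.inr ⟨⟨h1, h2⟩, h3, h⟩
    · exact Or.inl (Or.inl (Or.inr ⟨⟨h1, h2⟩, h, h4⟩))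

/-- Cutoff functions between concentric squares with the natural gradient bound. -/
theorem exists_cutoff : ∃ M : ℝ, 0 ≤ M ∧ ∀ (x : ℝ × ℝ) (R : ℝ), 0 < R →
    ∃ η, IsTestOn (closedBall x (3 * R)) η ∧ (∀ y, 0 ≤ η y) ∧
      (∀ y ∈ ball x R, η y = 1 ∧ ∀ j, pd j η y = 0) ∧ ∀ j y, |pd j η y| ≤ M / R := by
  -- All cutoffs are rescalings of this single bump, so M depends neither on the centre nor on R.
  let φ : ContDiffBump (0 : ℝ × ℝ) := ⟨1, 2, one_pos, one_lt_two⟩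
  obtain ⟨M, hM⟩ := (φ.contDiff (n := ⊤)).continuous_fderiv (by norm_num)
    |>.bounded_above_of_compact_support (φ.hasCompactSupport.fderiv ℝ)
  have hM0 : 0 ≤ M := (norm_nonneg _).trans (hM 0)
  refine ⟨M, hM0, fun x R hR => ⟨fun y => φ (R⁻¹ • (y - x)), ⟨?_, ?_, ?_⟩, fun y => φ.nonneg,
    fun y hy => ?_, fun j y => ?_⟩⟩
  · exact φ.contDiff.comp (g := φ) (f := fun y => R⁻¹ • (y - x)) (by fun_prop)
  · refine HasCompactSupport.intro (isCompact_closedBall x (3 * R)) fun y hy => ?_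
    refine φ.zero_of_le_dist ?_
    rw [mem_closedBall, not_le, dist_eq_norm] at hy
    rw [dist_zero_right, norm_smul, Real.norm_of_nonneg (by positivity), inv_mul_eq_div,
      le_div_iff₀ hR]
    change 2 * R ≤ _
    linarith
  · refine closure_minimal (fun y hy => ?_) isClosed_closedBall
    by_contra h
    refine hy (φ.zero_of_le_dist ?_)
    rw [mem_closedBall, not_le, dist_eq_norm] at h
    rw [dist_zero_right, norm_smul, Real.norm_of_nonneg (by positivity), inv_mul_eq_div,
      le_div_iff₀ hR]
    change 2 * R ≤ _
    linarith
  · have h1 : (fun y => φ (R⁻¹ • (y - x))) =ᶠ[𝓝 y] fun _ => 1 := by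
      filter_upwards [isOpen_ball.mem_nhds hy] with z hz
      refine φ.one_of_mem_closedBall ?_
      rw [mem_ball, dist_eq_norm] at hz
      rw [mem_closedBall_zero_iff, norm_smul, Real.norm_of_nonneg (by positivity),
        inv_mul_eq_div, div_le_iff₀ hR]
      change _ ≤ 1 * R
      linarith
    exact ⟨h1.self_of_nhds, fun j => by simp [pd, h1.fderiv_eq]⟩
  · have h1 := ((φ.contDiff (n := ⊤)).differentiable (by norm_num)
      (R⁻¹ • (y - x))).hasFDerivAt.comp y
        (((hasFDerivAt_id y).sub_const x).const_smul R⁻¹)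
    have h2 : pd j (fun y => φ (R⁻¹ • (y - x))) y =
        fderiv ℝ φ (R⁻¹ • (y - x)) (R⁻¹ • axis j) := by
      rw [pd, show (fun y => φ (R⁻¹ • (y - x))) = φ ∘ (R⁻¹ • fun y => id y - x) from rfl,
        h1.fderiv]
      rfl
    have haxis : ‖axis j‖ ≤ 1 := by fin_cases j <;> simp [axis, Prod.norm_def]
    rw [h2, map_smul, smul_eq_mul, abs_mul, abs_of_pos (inv_pos.2 hR), inv_mul_eq_div]
    gcongr
    exact ((fderiv ℝ φ (R⁻¹ • (y - x))).le_opNorm _).trans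
      ((mul_le_mul (hM _) haxis (norm_nonneg _) hM0).trans_eq (mul_one M))

/-- Widman's hole filling inequality. -/
theorem hole_filling {Λ : ℝ} (hΛ : 0 ≤ Λ) : ∃ K : ℝ, 1 ≤ K ∧
    ∀ (Ω : Set (ℝ × ℝ)) (u : Fin 2 → ℝ × ℝ → ℝ) (g F : Fin 2 → Fin 2 → ℝ × ℝ → ℝ),
      IsOpen Ω → (∀ i, HasWeakGrad Ω (u i) (g i)) → (∀ i j, MemLp (F i j) 2) →
      (∀ i, IsWeakDivFree Ω (F i)) →
      (∀ y, ∑ i, ∑ j, g i j y ^ 2 ≤ ∑ i, ∑ j, F i j y * g i j y) →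
      (∀ y, ∑ i, ∑ j, F i j y ^ 2 ≤ Λ * ∑ i, ∑ j, g i j y ^ 2) →
      ∀ (x : ℝ × ℝ) (R : ℝ), 0 < R → closedBall x (5 * R) ⊆ Ω →
        ∫ y in ball x R, ∑ i, ∑ j, g i j y ^ 2 ≤
          K * ∫ y in closedBall x (3 * R) \ ball x R, ∑ i, ∑ j, g i j y ^ 2 := by
  obtain ⟨M, hM0, hM⟩ := exists_cutoff
  refine ⟨Λ / 2 + 342648 * M ^ 2 + 1, by nlinarith [sq_nonneg M], ?_⟩
  intro Ω u g F hΩ hu hF2 hdiv hell hbd x R hR hxR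
  obtain ⟨η, hη, hη0, hη1, hηM⟩ := hM x R hR
  have hηΩ : IsTestOn Ω η := hη.mono ((closedBall_subset_closedBall (by linarith)).trans hxR)
  choose c hc using fun i => poincare_annulus (hu i) hR hxR
  set A := closedBall x (3 * R) \ ball x R with hA
  set S : ℝ × ℝ → ℝ := fun y => ∑ i, ∑ j, g i j y ^ 2 with hS
  set D : ℝ × ℝ → ℝ := fun y => ∑ i, (u i y - c i) ^ 2 with hD
  have hAm : MeasurableSet A := measurableSet_closedBall.diff measurableSet_ball
  have hAfin : volume A ≠ ⊤ :=
    measure_ne_top_of_subset sdiff_subset (isCompact_closedBall x (3 * R)).measure_lt_top.ne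
  have iS : Integrable S := integrable_finsetSum _ fun i _ => integrable_finsetSum _ fun j _ =>
    ((hu i).memLp_grad j).integrable_sq
  have iD : IntegrableOn D A := integrable_finsetSum _ fun i _ =>
    integrableOn_sub_const_sq (hu i).memLp (c i) hAfin
  have hSA : ∑ i, ∑ j, ∫ y in A, g i j y ^ 2 = ∫ y in A, S y := by
    rw [integral_finsetSum _ fun i _ => (integrable_finsetSum _ fun j _ =>
      ((hu i).memLp_grad j).integrable_sq.integrableOn)]
    refine Finset.sum_congr rfl fun i _ => ?_
    rw [integral_finsetSum _ fun j _ => ((hu i).memLp_grad j).integrable_sq.integrableOn]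
  have hDA : ∫ y in A, D y ≤ 342648 * R ^ 2 * ∫ y in A, S y := by
    rw [← hSA, Finset.mul_sum, integral_finsetSum _ fun i _ =>
      integrableOn_sub_const_sq (hu i).memLp (c i) hAfin]
    exact Finset.sum_le_sum fun i _ => hc i
  -- The integrand obtained by testing with η(u - c), split into the test functions ηu and cη.
  set H : ℝ × ℝ → ℝ := fun y => ∑ i, ((∑ j, F i j y * (η y * g i j y + u i y * pd j η y)) -
    c i * ∑ j, F i j y * pd j η y) with hH
  have i1 : ∀ i, Integrable fun y => ∑ j, F i j y * (η y * g i j y + u i y * pd j η y) := fun i =>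
    integrable_finsetSum _ fun j _ =>
      integrable_mul_memLp (hF2 i j) (((hu i).cutoff hηΩ).memLp_grad j)
  have i2 : ∀ i, Integrable fun y => ∑ j, F i j y * pd j η y := fun i =>
    integrable_finsetSum _ fun j _ => integrable_mul_memLp (hF2 i j) (hη.memLp_pd j)
  have iH : Integrable H := integrable_finsetSum _ fun i _ => (i1 i).sub ((i2 i).const_mul _)
  have hH0 : ∫ y, H y = 0 := by
    have i3 : ∀ i, Integrable fun y => (∑ j, F i j y * (η y * g i j y + u i y * pd j η y)) -
        c i * ∑ j, F i j y * pd j η y := fun i => (i1 i).sub ((i2 i).const_mul _)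
    simp only [hH]
    rw [integral_finsetSum _ fun i _ => i3 i]
    refine Finset.sum_eq_zero fun i _ => ?_
    rw [integral_sub (i1 i) ((i2 i).const_mul _), integral_const_mul,
      (hdiv i).integral_cutoff (hF2 i) hΩ (hu i) hηΩ, hdiv i η hηΩ]
    simp
  have hS0 : ∀ y, 0 ≤ S y := fun y =>
    Finset.sum_nonneg fun i _ => Finset.sum_nonneg fun j _ => sq_nonneg _
  -- On the ball H is F · ∇u, which dominates S. On the annulus the term η F · ∇u is nonnegative and
  -- is dropped, and Young's inequality bounds F · (u - c)∇η; nothing has to be absorbed, so η need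
  -- not be squared.
  have hpt : ∀ y, (ball x R).indicator S y -
      A.indicator (fun y => Λ / 2 * S y + (M / R) ^ 2 * D y) y ≤ H y := by
    intro y
    by_cases hy : y ∈ ball x R
    · have hyA : y ∉ A := fun h => h.2 hy
      rw [indicator_of_mem hy, indicator_of_notMem hyA, sub_zero]
      simp only [hH, (hη1 y hy).1, (hη1 y hy).2]
      simpa [hS] using hell y
    · rw [indicator_of_notMem hy]
      by_cases hyA : y ∈ A
      · rw [indicator_of_mem hyA]
        have e1 : H y = η y * (∑ i, ∑ j, F i j y * g i j y) +
            ∑ i, ∑ j, F i j y * ((u i y - c i) * pd j η y) := by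
          simp only [hH, Fin.sum_univ_two]
          ring
        have e2 : 0 ≤ η y * (∑ i, ∑ j, F i j y * g i j y) :=
          mul_nonneg (hη0 y) ((hS0 y).trans (hell y))
        have e3 : ∀ i j, -(F i j y ^ 2 / 2 + (M / R) ^ 2 * (u i y - c i) ^ 2 / 2) ≤
            F i j y * ((u i y - c i) * pd j η y) := fun i j => by
          have h1 : pd j η y ^ 2 ≤ (M / R) ^ 2 := sq_le_sq' (abs_le.1 (hηM j y)).1
            (abs_le.1 (hηM j y)).2
          have h2 := mul_le_mul_of_nonneg_right h1 (sq_nonneg (u i y - c i))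
          nlinarith [sq_nonneg (F i j y + (u i y - c i) * pd j η y)]
        have e4 := Finset.sum_le_sum fun i (_ : i ∈ Finset.univ) =>
          Finset.sum_le_sum fun j (_ : j ∈ Finset.univ) => e3 i j
        have e5 := hbd y
        rw [e1]
        simp only [hS, hD, Fin.sum_univ_two] at e2 e4 e5 ⊢
        linarith
      · rw [indicator_of_notMem hyA]
        have hyt : y ∉ tsupport η := fun h => hyA ⟨hη.support_subset h, hy⟩
        simp [hH, image_eq_zero_of_notMem_tsupport hyt, pd_eq_zero_of_notMem hyt]
  have iR : IntegrableOn (fun y => Λ / 2 * S y + (M / R) ^ 2 * D y) A :=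
    (iS.integrableOn.const_mul _).add (iD.const_mul _)
  have hint := integral_mono ((iS.indicator measurableSet_ball).sub (iR.integrable_indicator hAm))
    iH hpt
  simp only [Pi.sub_apply] at hint
  rw [hH0, integral_sub (iS.indicator measurableSet_ball) (iR.integrable_indicator hAm),
    integral_indicator measurableSet_ball, integral_indicator hAm,
    integral_add (iS.integrableOn.const_mul _) (iD.const_mul _), integral_const_mul,
    integral_const_mul] at hint
  have hSA0 : 0 ≤ ∫ y in A, S y := integral_nonneg hS0
  have h5 := mul_le_mul_of_nonneg_left hDA (sq_nonneg (M / R))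
  have h6 : (M / R) ^ 2 * (342648 * R ^ 2 * ∫ y in A, S y) = 342648 * M ^ 2 * ∫ y in A, S y := by
    field_simp
  rw [h6] at h5
  nlinarith

end HoleFilling

/-! ### Morrey's growth theorem and the elliptic regularity statement. -/

section Campanato

open Filter Topology Set Metric

variable {Ω : Set (ℝ × ℝ)} {u S : ℝ × ℝ → ℝ} {g : Fin 2 → ℝ × ℝ → ℝ}

theorem closedBall_eq_rect (x : ℝ × ℝ) (r : ℝ) :
    closedBall x r = Icc (x.1 - r) (x.1 + r) ×ˢ Icc (x.2 - r) (x.2 + r) := by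
  rw [← Real.closedBall_eq_Icc, ← Real.closedBall_eq_Icc, closedBall_prod_same]

theorem measureReal_square (x : ℝ × ℝ) {r : ℝ} (hr : 0 ≤ r) :
    volume.real (closedBall x r) = 4 * r ^ 2 := by
  rw [closedBall_eq_rect, measureReal_rect (by linarith) (by linarith)]
  ring

/-- The average over a square is close to any constant which is close to `u` in mean. -/
theorem sq_setAverage_sub_le (hu : MemLp u 2) {x : ℝ × ℝ} {r : ℝ} (hr : 0 < r) (m : ℝ) :
    4 * r ^ 2 * ((⨍ y in closedBall x r, u y) - m) ^ 2 ≤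
      ∫ y in closedBall x r, (u y - m) ^ 2 := by
  have hfin : volume (closedBall x r) ≠ ⊤ := (isCompact_closedBall x r).measure_lt_top.ne
  have : IsFiniteMeasure (volume.restrict (closedBall x r)) := ⟨by simpa using hfin.lt_top⟩
  have h1 := sq_integral_le ((hu.restrict (closedBall x r)).sub (memLp_const m))
  have h2 : ∫ y in closedBall x r, (u y - m) =
      4 * r ^ 2 * ((⨍ y in closedBall x r, u y) - m) := by
    rw [integral_sub ((hu.restrict _).integrable (by norm_num)) (integrable_const _),
      setAverage_eq, measureReal_square x hr.le]
    simp only [integral_const, measureReal_restrict_apply_univ, measureReal_square x hr.le,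
      smul_eq_mul]
    field_simp
  simp only [Pi.sub_apply, measureReal_restrict_apply_univ, measureReal_square x hr.le] at h1
  rw [h2] at h1
  have h3 : 4 * r ^ 2 * (4 * r ^ 2 * ((⨍ y in closedBall x r, u y) - m) ^ 2) ≤
      4 * r ^ 2 * ∫ y in closedBall x r, (u y - m) ^ 2 := by linarith
  exact le_of_mul_le_mul_left h3 (by positivity)

/-- Poincaré on a square of side 2r. The right side is relaxed to an open ball of radius 2r and to
the density S of the full system, since the decay is known for S and not for one component. -/
theorem setIntegral_sub_setAverage_sq_le (hu : HasWeakGrad Ω u g) (hS : Integrable S)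
    (hgS : ∀ y, ∑ j, g j y ^ 2 ≤ S y) {x : ℝ × ℝ} {r : ℝ} (hr : 0 < r)
    (hΩ : closedBall x (3 * r) ⊆ Ω) :
    ∫ y in closedBall x r, (u y - ⨍ z in closedBall x r, u z) ^ 2 ≤
      8 * r ^ 2 * ∫ y in ball x (2 * r), S y := by
  have h := poincare_rect hu (x := x) (r := 2 * r) (r' := 3 * r) (by linarith) (by linarith) hΩ
    (a := x.1 - r) (b := x.1 + r) (c := x.2 - r) (d := x.2 + r) (L := 2 * r)
    (by rw [← closedBall_eq_rect]; exact closedBall_subset_ball (by linarith))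
    (by linarith) (by linarith) (by linarith) (by linarith)
  rw [← closedBall_eq_rect] at h
  rw [setAverage_eq, smul_eq_mul, inv_mul_eq_div]
  refine h.trans ?_
  rw [show 2 * (2 * r) ^ 2 = 8 * r ^ 2 by ring, ← integral_finsetSum _ fun j _ =>
    (hu.memLp_grad j).integrable_sq.integrableOn]
  refine mul_le_mul_of_nonneg_left ?_ (by positivity)
  have hS0 : ∀ y, 0 ≤ S y := fun y =>
    (Finset.sum_nonneg fun j _ => sq_nonneg (g j y)).trans (hgS y)
  refine (setIntegral_mono (integrable_finsetSum _ fun j _ =>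
    (hu.memLp_grad j).integrable_sq.integrableOn) hS.integrableOn hgS).trans ?_
  exact setIntegral_mono_set hS.integrableOn (ae_of_all _ hS0)
    (LE.le.eventuallyLE (closedBall_subset_ball (by linarith)))

/-- Morrey's Dirichlet growth theorem: geometric decay of the Dirichlet integral on squares implies
local Hölder continuity. -/
theorem exists_holder_of_decay (hΩ : IsOpen Ω) (hu : HasWeakGrad Ω u g) (hS : Integrable S)
    (hgS : ∀ y, ∑ j, g j y ^ 2 ≤ S y) {α : ℝ} (hα : 0 < α)
    (hdec : ∀ (x : ℝ × ℝ) (r : ℝ), 0 < r → closedBall x (2 * r) ⊆ Ω →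
      ∫ y in ball x (r / 4), S y ≤ ((1 / 4 : ℝ) ^ α) ^ 2 * ∫ y in ball x r, S y) :
    ∃ v : ℝ × ℝ → ℝ, v =ᵐ[volume] u ∧ ∀ K, IsCompact K → K ⊆ Ω →
      ∃ C : ℝ, 0 ≤ C ∧ ∀ x ∈ K, ∀ y ∈ K, |v x - v y| ≤ C * dist x y ^ α := by
  set β : ℝ := (1 / 4 : ℝ) ^ α with hβ
  have hβ0 : 0 < β := Real.rpow_pos_of_pos (by norm_num) _
  have hβ1 : β < 1 := Real.rpow_lt_one (by norm_num) (by norm_num) hα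
  have hS0 : ∀ y, 0 ≤ S y := fun y =>
    (Finset.sum_nonneg fun j _ => sq_nonneg (g j y)).trans (hgS y)
  set q : ℕ → ℝ := fun n => (1 / 4 : ℝ) ^ n with hq
  have hq0 : ∀ n, 0 < q n := fun n => by positivity
  have hqs : ∀ n, q (n + 1) = q n / 4 := fun n => by simp only [hq, pow_succ]; ring
  have hqt : Tendsto q atTop (𝓝 0) :=
    tendsto_pow_atTop_nhds_zero_of_lt_one (by norm_num) (by norm_num)
  set a : ℕ → ℝ × ℝ → ℝ := fun n x => ⨍ y in closedBall x (q n), u y with ha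
  -- Lebesgue differentiation identifies v with u almost everywhere; on compact subsets of Ω the
  -- limit will be shown to exist at every point.
  set v : ℝ × ℝ → ℝ := fun x => limUnder atTop fun n => a n x with hv
  refine ⟨v, ?_, fun K hK hKΩ => ?_⟩
  · filter_upwards [IsUnifLocDoublingMeasure.ae_tendsto_average volume
      (hu.memLp.locallyIntegrable (by norm_num)) 1] with x hx
    refine Tendsto.limUnder_eq (hx (fun _ => x) q ?_ ?_)
    · exact tendsto_nhdsWithin_iff.2 ⟨hqt, Eventually.of_forall hq0⟩
    · exact Eventually.of_forall fun n => mem_closedBall_self (by linarith [hq0 n])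
  obtain ⟨δ, hδ, hδΩ⟩ := hK.exists_cthickening_subset_open hΩ hKΩ
  obtain ⟨N, hN⟩ := (hqt.eventually (gt_mem_nhds (half_pos hδ))).exists
  have hin : ∀ x ∈ K, closedBall x (2 * q N) ⊆ Ω := fun x hx =>
    ((closedBall_subset_closedBall (by linarith)).trans
      (closedBall_subset_cthickening hx δ)).trans hδΩ
  set M := ∫ y, S y with hM
  have hM0 : 0 ≤ M := integral_nonneg hS0
  have hdecay : ∀ x ∈ K, ∀ k, ∫ y in ball x (q (N + k)), S y ≤ (β ^ k) ^ 2 * M := by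
    intro x hx k
    induction k with
    | zero => simpa using setIntegral_le_integral hS (ae_of_all _ hS0)
    | succ k ih =>
      rw [← add_assoc, hqs]
      refine (hdec x (q (N + k)) (hq0 _) ?_).trans ?_
      · refine (closedBall_subset_closedBall ?_).trans (hin x hx)
        have : q (N + k) ≤ q N := pow_le_pow_of_le_one (by norm_num) (by norm_num) (by omega)
        linarith
      · calc _ ≤ β ^ 2 * ((β ^ k) ^ 2 * M) := mul_le_mul_of_nonneg_left ih (sq_nonneg _)
          _ = _ := by ring
  set C := √(32 * M) with hC
  have hC0 : 0 ≤ C := Real.sqrt_nonneg _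
  have hC2 : C ^ 2 = 32 * M := Real.sq_sqrt (by positivity)
  -- Allowing two centres serves twice: y = x gives the Cauchy estimate, and y ≠ x compares nearby
  -- points at the scale of their distance. The quarter square about y lies in the square about x;
  -- the ratio of areas turns the Poincaré constant into C² = 32M.
  have hstep : ∀ x ∈ K, ∀ y ∈ K, ∀ k, dist x y ≤ q (N + k + 2) →
      |a (N + k + 1) x - a (N + k + 2) y| ≤ C * β ^ k := by
    intro x hx y hy k hxy
    have hs0 : q (N + k + 2) = q (N + k + 1) / 4 := hqs _
    have hs1 : q (N + k + 1) = q (N + k) / 4 := hqs _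
    set s := q (N + k + 1) with hs
    have hspos : 0 < s := hq0 _
    have hqN : q (N + k) ≤ q N := pow_le_pow_of_le_one (by norm_num) (by norm_num) (by omega)
    have h1 := setIntegral_sub_setAverage_sq_le hu hS hgS (x := x) hspos
      ((closedBall_subset_closedBall (by linarith [hq0 N])).trans (hin x hx))
    have h2 := sq_setAverage_sub_le hu.memLp (x := y) (hq0 (N + k + 2)) (a (N + k + 1) x)
    have h3 : ∫ z in closedBall y (q (N + k + 2)), (u z - a (N + k + 1) x) ^ 2 ≤
        ∫ z in closedBall x s, (u z - a (N + k + 1) x) ^ 2 :=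
      setIntegral_mono_set (integrableOn_sub_const_sq hu.memLp _
        (isCompact_closedBall x s).measure_lt_top.ne) (ae_of_all _ fun _ => sq_nonneg _)
        (LE.le.eventuallyLE (closedBall_subset_closedBall' (by
          rw [dist_comm y x]; linarith)))
    have h4 : ∫ z in ball x (2 * s), S z ≤ ∫ z in ball x (q (N + k)), S z :=
      setIntegral_mono_set hS.integrableOn (ae_of_all _ hS0)
        (LE.le.eventuallyLE (ball_subset_ball (by linarith [hq0 (N + k)])))
    have h5 := h4.trans (hdecay x hx k)
    have h6 : 4 * q (N + k + 2) ^ 2 * (a (N + k + 2) y - a (N + k + 1) x) ^ 2 ≤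
        8 * s ^ 2 * ((β ^ k) ^ 2 * M) :=
      (h2.trans h3).trans (h1.trans (mul_le_mul_of_nonneg_left h5 (by positivity)))
    rw [hs0] at h6
    have h7 : (a (N + k + 2) y - a (N + k + 1) x) ^ 2 ≤ (C * β ^ k) ^ 2 := by
      rw [mul_pow, hC2]
      have : s ^ 2 * (a (N + k + 2) y - a (N + k + 1) x) ^ 2 ≤
        s ^ 2 * (32 * M * (β ^ k) ^ 2) := by linarith
      exact le_of_mul_le_mul_left this (by positivity)
    rw [abs_sub_comm]
    exact abs_le_of_sq_le_sq h7 (by positivity)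
  have hlim : ∀ x ∈ K, ∀ k, |a (N + k + 1) x - v x| ≤ C * β ^ k / (1 - β) := by
    intro x hx
    have hgeo : ∀ k, dist (a (N + k + 1) x) (a (N + (k + 1) + 1) x) ≤ C * β ^ k := fun k => by
      rw [Real.dist_eq]
      exact hstep x hx x hx k (by rw [dist_self]; exact (hq0 _).le)
    obtain ⟨l, hl⟩ := cauchySeq_tendsto_of_complete (cauchySeq_of_le_geometric β C hβ1 hgeo)
    have hl' : Tendsto (fun n => a n x) atTop (𝓝 l) := by
      rw [← tendsto_add_atTop_iff_nat (N + 1)]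
      exact hl.congr fun k => by rw [show N + k + 1 = k + (N + 1) by ring]
    have hvl : v x = l := hl'.limUnder_eq
    intro k
    have := dist_le_of_le_geometric_of_tendsto β C hβ1 hgeo hl k
    rwa [Real.dist_eq, ← hvl] at this
  have hb1 : 0 < 1 - β := sub_pos.2 hβ1
  set D := C / (1 - β) with hD
  have hD0 : 0 ≤ D := div_nonneg hC0 hb1.le
  have hCD : C ≤ D := le_div_self hC0 hb1 (by linarith)
  have hlim' : ∀ x ∈ K, ∀ k, |a (N + k + 1) x - v x| ≤ D * β ^ k := fun x hx k =>
    (hlim x hx k).trans_eq (by rw [hD]; ring)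
  set Q := √((∫ y, u y ^ 2) / (4 * q (N + 1) ^ 2)) with hQ
  have hQ0 : 0 ≤ Q := Real.sqrt_nonneg _
  -- This bound handles pairs of points too far apart for the comparison of averages.
  have hbound : ∀ x ∈ K, |v x| ≤ Q + D := by
    intro x hx
    have h1 := hlim' x hx 0
    have h2 := sq_setAverage_sub_le hu.memLp (x := x) (hq0 (N + 1)) 0
    simp only [sub_zero] at h2
    have h3 := h2.trans (setIntegral_le_integral hu.memLp.integrable_sq
      (ae_of_all _ fun _ => sq_nonneg _))
    have h4 : |a (N + 1) x| ≤ Q := by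
      refine Real.abs_le_sqrt ?_
      rw [le_div_iff₀ (by have := hq0 (N + 1); positivity), mul_comm]
      exact h3
    simp only [add_zero, pow_zero, mul_one] at h1
    have h5 := abs_sub_abs_le_abs_sub (v x) (a (N + 1) x)
    rw [abs_sub_comm] at h5
    linarith
  set Z : ℝ := (4 ^ (N + 3)) ^ α with hZ
  have hZ0 : 0 ≤ Z := by positivity
  refine ⟨(3 * D + 2 * (Q + D)) * Z, by positivity, fun x hx y hy => ?_⟩
  have hqN2 : ∀ k, q (N + k + 2) * 4 ^ (N + 2) = (1 / 4 : ℝ) ^ k := fun k => by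
    simp only [hq]
    rw [show N + k + 2 = k + (N + 2) by ring, pow_add, mul_assoc, ← mul_pow]
    norm_num
  have hZd : (4 ^ (N + 3) * dist x y) ^ α = Z * dist x y ^ α :=
    Real.mul_rpow (by positivity) dist_nonneg
  have hdα : 0 ≤ Z * dist x y ^ α := mul_nonneg hZ0 (Real.rpow_nonneg dist_nonneg _)
  rcases le_or_gt (dist x y * 4 ^ (N + 2)) 1 with hd | hd
  · rcases (dist_nonneg (x := x) (y := y)).eq_or_lt with h0 | h0
    · rw [dist_eq_zero.1 h0.symm]
      simp [Real.zero_rpow hα.ne']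
    · obtain ⟨k, hk1, hk2⟩ := exists_nat_pow_near_of_lt_one (x := dist x y * 4 ^ (N + 2))
        (y := (1 / 4 : ℝ)) (by positivity) hd (by norm_num) (by norm_num)
      have hdist : dist x y ≤ q (N + k + 2) := by
        rw [← hqN2 k] at hk2
        exact le_of_mul_le_mul_right hk2 (by positivity)
      have e1 := hlim' x hx k
      have e2 := hstep x hx y hy k hdist
      have e3 := hlim' y hy (k + 1)
      have hbk : 0 < β ^ k := by positivity
      have e4 : D * β ^ (k + 1) ≤ D * β ^ k :=
        mul_le_mul_of_nonneg_left (pow_le_pow_of_le_one hβ0.le hβ1.le (by omega)) hD0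
      have e5 : C * β ^ k ≤ D * β ^ k := mul_le_mul_of_nonneg_right hCD hbk.le
      have e6 : |v x - v y| ≤ 3 * D * β ^ k := by
        have e7 : v x - v y = -(a (N + k + 1) x - v x) +
          (a (N + k + 1) x - a (N + k + 2) y) + (a (N + (k + 1) + 1) y - v y) := by
          rw [show N + (k + 1) + 1 = N + k + 2 by ring]; ring
        rw [e7]
        refine (abs_add_three _ _ _).trans ?_
        rw [abs_neg]
        linarith
      have e8 : β ^ k ≤ Z * dist x y ^ α := by
        rw [← hZd, hβ, ← Real.rpow_natCast, ← Real.rpow_mul (by norm_num), mul_comm α,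
          Real.rpow_mul (by norm_num), Real.rpow_natCast]
        refine Real.rpow_le_rpow (by positivity) ?_ hα.le
        rw [pow_succ] at hk1
        rw [pow_succ 4 (N + 2)]
        linarith
      calc |v x - v y| ≤ 3 * D * β ^ k := e6
        _ ≤ 3 * D * (Z * dist x y ^ α) := mul_le_mul_of_nonneg_left e8 (by positivity)
        _ ≤ (3 * D + 2 * (Q + D)) * (Z * dist x y ^ α) :=
          mul_le_mul_of_nonneg_right (by linarith) hdα
        _ = _ := by ring
  · have e1 : 1 ≤ Z * dist x y ^ α := by
      rw [← hZd]
      refine Real.one_le_rpow ?_ hα.le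
      rw [pow_succ]
      linarith
    have e2 := (abs_sub (v x) (v y)).trans (add_le_add (hbound x hx) (hbound y hy))
    calc |v x - v y| ≤ 2 * (Q + D) * 1 := by linarith
      _ ≤ 2 * (Q + D) * (Z * dist x y ^ α) := mul_le_mul_of_nonneg_left e1 (by positivity)
      _ ≤ (3 * D + 2 * (Q + D)) * (Z * dist x y ^ α) :=
        mul_le_mul_of_nonneg_right (by linarith) hdα
      _ = _ := by ring

/-- Local Hölder continuity of weak solutions of elliptic equations in divergence form, where the
ellipticity and growth bounds are only required along the solution. -/
theorem exists_holder_of_elliptic {Λ : ℝ} (hΛ : 0 ≤ Λ) : ∃ α : ℝ, 0 < α ∧ α < 1 ∧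
    ∀ (Ω : Set (ℝ × ℝ)) (u : Fin 2 → ℝ × ℝ → ℝ) (g F : Fin 2 → Fin 2 → ℝ × ℝ → ℝ),
      IsOpen Ω → (∀ i, HasWeakGrad Ω (u i) (g i)) → (∀ i j, MemLp (F i j) 2) →
      (∀ i, IsWeakDivFree Ω (F i)) →
      (∀ y, ∑ i, ∑ j, g i j y ^ 2 ≤ ∑ i, ∑ j, F i j y * g i j y) →
      (∀ y, ∑ i, ∑ j, F i j y ^ 2 ≤ Λ * ∑ i, ∑ j, g i j y ^ 2) →
      ∀ i, ∃ v : ℝ × ℝ → ℝ, v =ᵐ[volume] u i ∧ ∀ K, IsCompact K → K ⊆ Ω →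
        ∃ C : ℝ, 0 ≤ C ∧ ∀ x ∈ K, ∀ y ∈ K, |v x - v y| ≤ C * dist x y ^ α := by
  obtain ⟨K, hK1, hK⟩ := hole_filling hΛ
  -- Filling the hole gives decay by θ under division of the radius by 4, so α solves (1/4)^α = √θ.
  -- From K ≥ 1 follows θ ≥ 1/2, hence √θ > 1/4 and α < 1.
  set θ := K / (K + 1) with hθ
  have hθ1 : θ < 1 := (div_lt_one (by linarith)).2 (by linarith)
  have hθ2 : 1 / 2 ≤ θ := by rw [hθ, div_le_div_iff₀ (by norm_num) (by linarith)]; linarith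
  have hβ2 : √θ ^ 2 = θ := Real.sq_sqrt (by linarith)
  have hβ0 : 0 < √θ := Real.sqrt_pos.2 (by linarith)
  have hβ1 : √θ < 1 := by nlinarith
  have hβ4 : 1 / 4 < √θ := by nlinarith
  have hpow : (1 / 4 : ℝ) ^ Real.logb (1 / 4) √θ = √θ :=
    Real.rpow_logb (by norm_num) (by norm_num) hβ0
  refine ⟨Real.logb (1 / 4) √θ, ?_, ?_, ?_⟩
  · exact Real.logb_pos_of_base_lt_one (by norm_num) (by norm_num) hβ0 hβ1
  · by_contra! h
    have := Real.rpow_le_rpow_of_exponent_ge (x := (1 / 4 : ℝ)) (by norm_num) (by norm_num) h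
    rw [hpow, Real.rpow_one] at this
    linarith
  intro Ω u g F hΩ hu hF2 hdiv hell hbd i
  set S : ℝ × ℝ → ℝ := fun y => ∑ i, ∑ j, g i j y ^ 2 with hS
  have iS : Integrable S := integrable_finsetSum _ fun i _ => integrable_finsetSum _ fun j _ =>
    ((hu i).memLp_grad j).integrable_sq
  have hS0 : ∀ y, 0 ≤ S y := fun y =>
    Finset.sum_nonneg fun i _ => Finset.sum_nonneg fun j _ => sq_nonneg _
  refine exists_holder_of_decay hΩ (hu i) iS (fun y => ?_)
    (Real.logb_pos_of_base_lt_one (by norm_num) (by norm_num) hβ0 hβ1) fun x r hr hxr => ?_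
  · exact Finset.single_le_sum (f := fun i => ∑ j, g i j y ^ 2)
      (fun i _ => Finset.sum_nonneg fun j _ => sq_nonneg _) (Finset.mem_univ i)
  · rw [hpow, hβ2]
    have h1 := hK Ω u g F hΩ hu hF2 hdiv hell hbd x (r / 4) (by linarith)
      ((closedBall_subset_closedBall (by linarith)).trans hxr)
    have hsub : ball x (r / 4) ⊆ ball x r := ball_subset_ball (by linarith)
    have h2 : ∫ y in closedBall x (3 * (r / 4)) \ ball x (r / 4), S y ≤
        ∫ y in ball x r \ ball x (r / 4), S y :=
      setIntegral_mono_set iS.integrableOn (ae_of_all _ hS0)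
        (LE.le.eventuallyLE (sdiff_subset_sdiff_left (closedBall_subset_ball (by linarith))))
    -- The annulus integral becomes a difference, and the hole's share moves to the left side.
    rw [setIntegral_sdiff measurableSet_ball iS.integrableOn hsub] at h2
    have h3 := h1.trans (mul_le_mul_of_nonneg_left h2 (by linarith))
    rw [hθ, div_mul_eq_mul_div, le_div_iff₀ (by linarith)]
    linarith

end Campanato

/-! ### Transfer between the Euclidean plane and ℝ × ℝ. -/

section Transport

open Filter Topology Set

/-- The identification of the Euclidean plane with `ℝ × ℝ`. -/
noncomputable def planeEquiv : Plane ≃L[ℝ] ℝ × ℝ :=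
  (EuclideanSpace.equiv (Fin 2) ℝ).trans (ContinuousLinearEquiv.finTwoArrow ℝ ℝ)

theorem planeEquiv_apply (x : Plane) : planeEquiv x = (x 0, x 1) := rfl

theorem measurePreserving_planeEquiv : MeasurePreserving planeEquiv :=
  (volume_preserving_finTwoArrow ℝ).comp (PiLp.volume_preserving_ofLp (Fin 2))

theorem measurableEmbedding_planeEquiv : MeasurableEmbedding planeEquiv :=
  planeEquiv.toHomeomorph.measurableEmbedding

theorem measurePreserving_planeEquiv_symm : MeasurePreserving planeEquiv.symm :=
  measurePreserving_planeEquiv.symm planeEquiv.toHomeomorph.toMeasurableEquiv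

/-- A scalar function on `Ω`, extended by zero and considered as a function on `ℝ × ℝ`. -/
noncomputable def planeLift (Ω : Set Plane) (f : Plane → ℝ) (y : ℝ × ℝ) : ℝ :=
  Ω.indicator f (planeEquiv.symm y)

variable {Ω : Set Plane}

theorem memLp_planeLift (hΩ : IsOpen Ω) {f : Plane → ℝ} (hf : MemLp f 2 (volume.restrict Ω)) :
    MemLp (planeLift Ω f) 2 :=
  ((memLp_indicator_iff_restrict hΩ.measurableSet).2 hf).comp_measurePreserving
    measurePreserving_planeEquiv_symm

theorem integral_eq_setIntegral_planeEquiv (hΩ : IsOpen Ω) {h : ℝ × ℝ → ℝ} {f : Plane → ℝ}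
    (hh : ∀ x, h (planeEquiv x) = Ω.indicator f x) : ∫ y, h y = ∫ x in Ω, f x := by
  rw [← measurePreserving_planeEquiv.integral_comp measurableEmbedding_planeEquiv,
    ← integral_indicator hΩ.measurableSet]
  simp_rw [hh]

theorem isTestFunction_comp_planeEquiv {ψ : ℝ × ℝ → ℝ}
    (hψ : IsTestOn (planeEquiv.symm ⁻¹' Ω) ψ) : IsTestFunction Ω (ψ ∘ planeEquiv) := by
  refine ⟨hψ.smooth.comp planeEquiv.contDiff, hψ.compact.comp_homeomorph planeEquiv.toHomeomorph,
    (tsupport_comp_subset_preimage ψ planeEquiv.continuous).trans fun x hx => ?_⟩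
  simpa using hψ.support_subset hx

theorem planeEquiv_single (j : Fin 2) :
    planeEquiv (EuclideanSpace.single j (1 : ℝ)) = axis j := by
  fin_cases j <;> simp [planeEquiv_apply, axis]

theorem partialDeriv_comp_planeEquiv (ψ : ℝ × ℝ → ℝ) (j : Fin 2) (x : Plane) :
    partialDeriv j (ψ ∘ planeEquiv) x = pd j ψ (planeEquiv x) := by
  rw [partialDeriv, pd, planeEquiv.comp_right_fderiv, ← planeEquiv_single]
  rfl

theorem hasWeakGrad_planeLift (hΩ : IsOpen Ω) {u : Plane → Plane} {G : Plane → Mat2}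
    (hu : IsW12WithGrad Ω u G) (i : Fin 2) :
    HasWeakGrad (planeEquiv.symm ⁻¹' Ω) (planeLift Ω fun x => u x i)
      fun j => planeLift Ω fun x => G x i j := by
  refine ⟨memLp_planeLift hΩ ?_, fun j => memLp_planeLift hΩ (hu.memLp_grad i j),
    fun j ψ hψ => ?_⟩
  · exact hu.memLp.of_le ((EuclideanSpace.proj (𝕜 := ℝ) i).continuous.comp_aestronglyMeasurable
      hu.memLp.aestronglyMeasurable) (ae_of_all _ fun x => PiLp.norm_apply_le (u x) i)
  · have h := hu.weak_deriv i j _ (isTestFunction_comp_planeEquiv hψ)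
    rw [integral_eq_setIntegral_planeEquiv hΩ (f := fun x => u x i *
        partialDeriv j (ψ ∘ planeEquiv) x) fun x => ?_, h,
      integral_eq_setIntegral_planeEquiv hΩ (f := fun x => G x i j * (ψ ∘ planeEquiv) x)
        fun x => ?_]
    · by_cases hx : x ∈ Ω <;> simp [planeLift, hx]
    · by_cases hx : x ∈ Ω <;> simp [planeLift, hx, partialDeriv_comp_planeEquiv]

/-- Vector fields ψ eᵢ have a gradient concentrated in row i, which splits the system into one
scalar divergence equation per row. -/
theorem gradMatrix_smul_single {ψ : Plane → ℝ} (hψ : ContDiff ℝ ∞ ψ) (i k j : Fin 2) (x : Plane) :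
    gradMatrix (fun x => ψ x • EuclideanSpace.single i (1 : ℝ)) x k j =
      if k = i then partialDeriv j ψ x else 0 := by
  have h := ((hψ.differentiable (by norm_num) x).hasFDerivAt.smul_const
    (EuclideanSpace.single i (1 : ℝ))).fderiv
  simp only [gradMatrix, partialDeriv, Matrix.of_apply]
  rw [h]
  simp

/-- The rows of a weak solution of a system in divergence form are weakly divergence free. -/
theorem isWeakDivFree_planeLift (hΩ : IsOpen Ω) {F : Plane → Mat2}
    (hF : ∀ φ : Plane → Plane, IsTestFunction Ω φ →
      ∫ x in Ω, frobInner (F x) (gradMatrix φ x) = 0) (i : Fin 2) :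
    IsWeakDivFree (planeEquiv.symm ⁻¹' Ω) fun j => planeLift Ω fun x => F x i j := by
  intro ψ hψ
  have hψ' := isTestFunction_comp_planeEquiv hψ
  have h := hF (fun x => (ψ ∘ planeEquiv) x • EuclideanSpace.single i (1 : ℝ))
    ⟨hψ'.smooth.smul contDiff_const, hψ'.compact.smul_right,
      (tsupport_smul_subset_left _ _).trans hψ'.support_subset⟩
  rw [← h]
  refine integral_eq_setIntegral_planeEquiv hΩ fun x => ?_
  by_cases hx : x ∈ Ω
  · simp only [planeLift, indicator_of_mem hx, ContinuousLinearEquiv.symm_apply_apply, frobInner,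
      gradMatrix_smul_single hψ'.smooth, partialDeriv_comp_planeEquiv]
    simp
  · simp [planeLift, hx]

/-- A map on the plane is locally Hölder continuous if its components are, in the coordinates of
`ℝ × ℝ`. -/
theorem isLocallyHolder_of_planeLift (hΩ : IsOpen Ω) {u : Plane → Plane} {α : ℝ≥0}
    (h : ∀ i, ∃ v : ℝ × ℝ → ℝ, v =ᵐ[volume] planeLift Ω (fun x => u x i) ∧
      ∀ K, IsCompact K → K ⊆ planeEquiv.symm ⁻¹' Ω →
        ∃ C : ℝ, 0 ≤ C ∧ ∀ x ∈ K, ∀ y ∈ K, |v x - v y| ≤ C * dist x y ^ (α : ℝ)) :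
    IsLocallyHolder Ω α u := by
  choose v hv hK using h
  refine ⟨fun x => WithLp.toLp 2 fun i => v i (planeEquiv x), ?_, fun K hKc hKΩ => ?_⟩
  · have h1 : ∀ i, (fun x => v i (planeEquiv x)) =ᵐ[volume] Ω.indicator fun x => u x i := fun i => by
      filter_upwards [measurePreserving_planeEquiv.quasiMeasurePreserving.ae_eq_comp (hv i)]
        with x hx
      simpa [planeLift] using hx
    filter_upwards [ae_restrict_of_ae (h1 0), ae_restrict_of_ae (h1 1),
      ae_restrict_mem hΩ.measurableSet] with x h0 h1 hx
    ext i
    fin_cases i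
    · simpa [hx] using h0
    · simpa [hx] using h1
  · have hc : IsCompact (planeEquiv '' K) := hKc.image planeEquiv.continuous
    have hs : planeEquiv '' K ⊆ planeEquiv.symm ⁻¹' Ω := by
      rintro _ ⟨x, hx, rfl⟩
      simpa using hKΩ hx
    choose C hC0 hC using fun i => hK i _ hc hs
    refine ⟨(C 0 + C 1).toNNReal, fun x hx y hy => ?_⟩
    have hdist : dist (planeEquiv x) (planeEquiv y) ≤ dist x y := by
      rw [dist_eq_norm, dist_eq_norm, ← map_sub, planeEquiv_apply, Prod.norm_def]
      exact max_le (PiLp.norm_apply_le (x - y) 0) (PiLp.norm_apply_le (x - y) 1)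
    have hi : ∀ i, |v i (planeEquiv x) - v i (planeEquiv y)| ≤ C i * dist x y ^ (α : ℝ) :=
      fun i => (hC i _ (mem_image_of_mem _ hx) _ (mem_image_of_mem _ hy)).trans
        (mul_le_mul_of_nonneg_left (Real.rpow_le_rpow dist_nonneg hdist α.coe_nonneg) (hC0 i))
    have hd : dist (WithLp.toLp 2 fun i => v i (planeEquiv x) : Plane)
        (WithLp.toLp 2 fun i => v i (planeEquiv y)) ≤ (C 0 + C 1) * dist x y ^ (α : ℝ) := by
      rw [EuclideanSpace.dist_eq, Fin.sum_univ_two, add_mul]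
      simp only [Real.dist_eq]
      refine (Real.sqrt_le_sqrt (y := (|v 0 (planeEquiv x) - v 0 (planeEquiv y)| +
        |v 1 (planeEquiv x) - v 1 (planeEquiv y)|) ^ 2) ?_).trans ?_
      · nlinarith [abs_nonneg (v 0 (planeEquiv x) - v 0 (planeEquiv y)),
          abs_nonneg (v 1 (planeEquiv x) - v 1 (planeEquiv y))]
      · rw [Real.sqrt_sq (by positivity)]
        exact add_le_add (hi 0) (hi 1)
    rw [edist_dist, edist_dist, ENNReal.ofReal_rpow_of_nonneg dist_nonneg α.coe_nonneg]
    change _ ≤ ENNReal.ofReal (C 0 + C 1) * _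
    rw [← ENNReal.ofReal_mul (add_nonneg (hC0 0) (hC0 1))]
    exact ENNReal.ofReal_le_ofReal hd

end Transport

/-! ### Bounds and sign of ρ'. -/

section Rho

open Filter Topology Set

variable {γ s₀ κ : ℝ} {ρ : ℝ → ℝ}

theorem IsAdmissibleRho.continuous_deriv (hρ : IsAdmissibleRho γ s₀ κ ρ) :
    Continuous (deriv ρ) :=
  hρ.smooth.continuous_deriv (by norm_num)

/-- Locally constant ρ settles s < 0; continuity of ρ' adds the endpoint, which the monotonicity
argument on [0, s₀] needs. -/
theorem IsAdmissibleRho.deriv_of_nonpos (hρ : IsAdmissibleRho γ s₀ κ ρ) {s : ℝ} (hs : s ≤ 0) :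
    deriv ρ s = 0 := by
  have h1 : Iio (0 : ℝ) ⊆ {t | deriv ρ t = 0} := fun t ht => by
    have : ρ =ᶠ[𝓝 t] fun _ => 0 := by
      filter_upwards [Iio_mem_nhds ht] with r hr using hρ.eq_zero r (le_of_lt hr)
    simp [this.deriv_eq]
  have h2 := closure_minimal h1 (isClosed_eq hρ.continuous_deriv continuous_const)
  rw [closure_Iio] at h2
  exact h2 hs

theorem IsAdmissibleRho.deriv_of_ge (hρ : IsAdmissibleRho γ s₀ κ ρ) {s : ℝ} (hs : s₀ ≤ s) :
    deriv ρ s = γ := by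
  have h1 : Ioi s₀ ⊆ {t | deriv ρ t = γ} := fun t ht => by
    have : ρ =ᶠ[𝓝 t] fun r => γ * r + κ := by
      filter_upwards [Ioi_mem_nhds ht] with r hr using hρ.eq_affine r (le_of_lt hr)
    have h3 : HasDerivAt (fun r => γ * r + κ) γ t := by
      simpa using ((hasDerivAt_id t).const_mul γ).add_const κ
    simp [this.deriv_eq, h3.deriv]
  have h2 := closure_minimal h1 (isClosed_eq hρ.continuous_deriv continuous_const)
  rw [closure_Ioi] at h2
  exact h2 hs

/-- Convexity makes ρ' monotone on [0, s₀], where it runs from 0 to γ; outside it is constant. -/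
theorem IsAdmissibleRho.deriv_mem_Icc (hρ : IsAdmissibleRho γ s₀ κ ρ) (hγ : 0 < γ) (s : ℝ) :
    deriv ρ s ∈ Icc 0 γ := by
  rcases le_total s 0 with hs | hs
  · rw [hρ.deriv_of_nonpos hs]
    exact ⟨le_rfl, hγ.le⟩
  rcases le_total s₀ s with hs' | hs'
  · rw [hρ.deriv_of_ge hs']
    exact ⟨hγ.le, le_rfl⟩
  have hm := hρ.convex.monotoneOn_deriv fun x _ => hρ.smooth.differentiable (by norm_num) x
  have h0 := hm ⟨le_rfl, hs.trans hs'⟩ ⟨hs, hs'⟩ hs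
  have h1 := hm ⟨hs, hs'⟩ ⟨hs.trans hs', le_rfl⟩ hs'
  rw [hρ.deriv_of_nonpos le_rfl] at h0
  rw [hρ.deriv_of_ge le_rfl] at h1
  exact ⟨h0, h1⟩

theorem IsAdmissibleRho.deriv_mul_self_nonneg (hρ : IsAdmissibleRho γ s₀ κ ρ) (hγ : 0 < γ)
    (s : ℝ) : 0 ≤ deriv ρ s * s := by
  rcases le_total s 0 with hs | hs
  · simp [hρ.deriv_of_nonpos hs]
  · exact mul_nonneg (hρ.deriv_mem_Icc hγ s).1 hs

end Rho

/-! ### Pointwise coercivity and growth of the stress. -/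

section Stress

theorem cof_eq (A : Mat2) : cof A = !![A 1 1, -A 1 0; -A 0 1, A 0 0] := by
  rw [cof, Matrix.adjugate_fin_two]
  ext i j
  fin_cases i <;> fin_cases j <;> rfl

/-- Coercivity: A · cof A = 2 det A, so the extra term has the sign of c det A. -/
theorem frobInner_self_le {c : ℝ} {A : Mat2} (hc : 0 ≤ c * A.det) :
    ∑ i, ∑ j, A i j ^ 2 ≤ ∑ i, ∑ j, (A + c • cof A) i j * A i j := by
  rw [Matrix.det_fin_two] at hc
  simp [Fin.sum_univ_two, cof_eq]
  nlinarith

/-- Growth: cof permutes the entries up to sign, so |cof A| = |A|, and (a + cb)² ≤ 2a² + 2γ²b²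
entrywise. -/
theorem sum_sq_add_smul_cof_le {c γ : ℝ} (hc : c ∈ Set.Icc 0 γ) (A : Mat2) :
    ∑ i, ∑ j, (A + c • cof A) i j ^ 2 ≤ 2 * (1 + γ ^ 2) * ∑ i, ∑ j, A i j ^ 2 := by
  have hc2 : c ^ 2 ≤ γ ^ 2 := pow_le_pow_left₀ hc.1 hc.2 2
  have key : ∀ a b : ℝ, (a + c * b) ^ 2 ≤ 2 * a ^ 2 + 2 * (γ ^ 2 * b ^ 2) := fun a b => by
    nlinarith [sq_nonneg (a - c * b), mul_le_mul_of_nonneg_right hc2 (sq_nonneg b)]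
  have h00 := key (A 0 0) (A 1 1)
  have h01 := key (A 0 1) (-A 1 0)
  have h10 := key (A 1 0) (-A 0 1)
  have h11 := key (A 1 1) (A 0 0)
  simp only [neg_sq] at h01 h10
  simp only [Fin.sum_univ_two, cof_eq, Matrix.add_apply, Matrix.smul_apply, Matrix.of_apply,
    Matrix.cons_val', Matrix.cons_val_zero, Matrix.cons_val_one, Matrix.cons_val_fin_one,
    smul_eq_mul]
  linarith

/-- The determinant is merely integrable, but it enters only through a bounded factor, so the stress
stays in L² and can be paired with W^{1,2} test functions. -/
theorem memLp_add_smul_cof {α : Type*} [MeasurableSpace α] {ν : Measure α} {G : α → Mat2}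
    (hG : ∀ i j, MemLp (fun x => G x i j) 2 ν) {f : ℝ → ℝ} (hf : Continuous f) {γ : ℝ}
    (hfγ : ∀ s, f s ∈ Set.Icc 0 γ) (i j : Fin 2) :
    MemLp (fun x => (G x + f (G x).det • cof (G x)) i j) 2 ν := by
  have hm : AEStronglyMeasurable (fun x => f (G x).det) ν := by
    refine hf.comp_aestronglyMeasurable ?_
    simp_rw [Matrix.det_fin_two]
    exact ((hG 0 0).aestronglyMeasurable.mul (hG 1 1).aestronglyMeasurable).sub
      ((hG 0 1).aestronglyMeasurable.mul (hG 1 0).aestronglyMeasurable)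
  have hcof : MemLp (fun x => cof (G x) i j) 2 ν := by
    simp_rw [cof_eq]
    fin_cases i <;> fin_cases j
    · exact hG 1 1
    · exact (hG 1 0).neg
    · exact (hG 0 1).neg
    · exact hG 0 0
  refine (hG i j).add (hcof.of_le_mul (c := γ) (hm.mul hcof.aestronglyMeasurable)
    (Filter.Eventually.of_forall fun x => ?_))
  rw [Matrix.smul_apply, norm_smul, Real.norm_of_nonneg (hfγ _).1]
  exact mul_le_mul_of_nonneg_right (hfγ _).2 (norm_nonneg _)

end Stress

theorem theorem2p2p1
    (Ω : Set Plane) (hΩ : IsOpen Ω) (hΩb : Bornology.IsBounded Ω)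
    (γ s₀ κ : ℝ) (hγ : 0 < γ) (hs₀ : 0 ≤ s₀) (hκ : -(γ * s₀) ≤ κ)
    (ρ : ℝ → ℝ) (hρ : IsAdmissibleRho γ s₀ κ ρ)
    (u : Plane → Plane) (G : Plane → Mat2) (hu : IsW12WithGrad Ω u G)
    (hEL : WeakEulerLagrange Ω ρ G) :
    ∃ α : ℝ≥0, 0 < α ∧ α < 1 ∧ IsLocallyHolder Ω α u := by
  have hdet := hρ.deriv_mem_Icc hγ
  -- Λ is the growth constant of the stress. The exponent depends on Λ alone, so both components of
  -- u share it.
  obtain ⟨α, hα0, hα1, hα⟩ := exists_holder_of_elliptic (Λ := 2 * (1 + γ ^ 2)) (by positivity)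
  lift α to ℝ≥0 using hα0.le
  refine ⟨α, mod_cast hα0, mod_cast hα1, isLocallyHolder_of_planeLift hΩ ?_⟩
  refine hα (planeEquiv.symm ⁻¹' Ω) (fun i => planeLift Ω fun x => u x i)
    (fun i j => planeLift Ω fun x => G x i j)
    (fun i j => planeLift Ω fun x => (G x + deriv ρ (G x).det • cof (G x)) i j)
    (hΩ.preimage planeEquiv.symm.continuous) (hasWeakGrad_planeLift hΩ hu)
    (fun i j => memLp_planeLift hΩ
      (memLp_add_smul_cof hu.memLp_grad hρ.continuous_deriv hdet i j))
    (isWeakDivFree_planeLift hΩ hEL) (fun y => ?_) fun y => ?_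
  · by_cases hy : planeEquiv.symm y ∈ Ω
    · simp only [planeLift, Set.indicator_of_mem hy]
      exact frobInner_self_le (hρ.deriv_mul_self_nonneg hγ _)
    · simp [planeLift, hy]
  · by_cases hy : planeEquiv.symm y ∈ Ω
    · simp only [planeLift, Set.indicator_of_mem hy]
      exact sum_sq_add_smul_cof_le (hdet _) _
    · simp [planeLift, hy]
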